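/- Let $k$ be a field and let $\Sigma$ be a simplicial complex on the vertex set $V=\{v_1,\dots,v_n\}$: a set of subsets of $V$ (the faces) containing $\varnothing$ and every $\{v_i\}$ and closed under passing to subsets. The dimension of a face is its number of elements minus one, and $\dim\Sigma$ is the maximal dimension of a face. For a face $\sigma$ the link is $\operatorname{lk}\sigma=\{\tau\in\Sigma \mid \sigma\cap\tau=\varnothing,\ \sigma\cup\tau\in\Sigma\}$. Let $\tilde H_i$ and $\tilde H^i$ ($i\in\mathbb Z$) denote reduced simplicial homology and cohomology, i.e. the homology of the augmented (co)chain complex, in which the empty face has degree $-1$. Let $R=k[X_1,\dots,X_n]$, let $k[\Sigma]=R/I_\Sigma$ be the face ring, where $I_\Sigma$ is generated by the monomials $\prod_{v_i\in s}X_i$ with $s\subseteq V$, $s\notin\Sigma$, and regard $k=R/(X_1,\dots,X_n)$ as an $R$-module. Suppose that $\Sigma$ is pure of dimension $d$ (all maximal faces have dimension $d=\dim\Sigma$) and that \[ \tilde H_i(\operatorname{lk}\sigma,k)=0\qquad\text{for every non-empty face } \sigma\in\Sigma \text{ and every } i<\dim(\operatorname{lk}\sigma). \] Then for every $i>n-d-1$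 there is an isomorphism of $R$-modules (the $X_l$ acting by zero on the right-hand side) \[ \operatorname{Tor}_i^R(k[\Sigma],k)\;\cong\;\bigoplus_{j=0}^{n}\tilde H^{\,j-i-1}\bigl(\Sigma,\textstyle\bigwedge^j k^n\bigr). \] Moreover, the following are equivalent: (a) $\tilde H_i(\Sigma,k)=0$ for all $i<d$; (b) $\operatorname{Tor}_i^R(k[\Sigma],k)=0$ for all $i>n-d-1$; (c) $k[\Sigma]$ is a Cohen–Macaulay ring. -/

import Mathlib

universe u

/-- A finite simplicial complex with vertices taken from `V`: a finite set of finite subsets of `V`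
(the faces), closed under passing to subsets, with the empty face included. Not every element of
`V` has to be a vertex, so that links are complexes over the same `V`. -/
structure FaceComplex (V : Type) where
  faces : Finset (Finset V)
  empty_mem : ∅ ∈ faces
  down_closed : ∀ ⦃σ τ : Finset V⦄, σ ∈ faces → τ ⊆ σ → τ ∈ faces

namespace FaceComplex

/-- The dimension: the maximal cardinality of a face, minus one (`-1` for the complex `{∅}`). -/
def dim {V : Type} (K : FaceComplex V) : ℤ := ((K.faces.sup Finset.card : ℕ) : ℤ) - 1

/-- All maximal faces have the same dimension. -/
def IsPure {V : Type} (K : FaceComplex V) : Prop :=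
  ∀ σ τ : Finset V, Maximal (· ∈ K.faces) σ → Maximal (· ∈ K.faces) τ → σ.card = τ.card

/-- The link of a face `σ`: the faces `τ` disjoint from `σ` such that `σ ∪ τ` is a face. -/
def link {V : Type} [DecidableEq V] (K : FaceComplex V) (σ : Finset V) (hσ : σ ∈ K.faces) :
    FaceComplex V where
  faces := K.faces.filter fun τ => Disjoint σ τ ∧ σ ∪ τ ∈ K.faces
  empty_mem := by simp [K.empty_mem, hσ]
  down_closed := by
    intro τ ρ hτ hρ
    rw [Finset.mem_filter] at hτ ⊢
    exact ⟨K.down_closed hτ.1 hρ, hτ.2.1.mono_right hρ,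
      K.down_closed hτ.2.2 (Finset.union_subset_union_right hρ)⟩

/-- The faces of dimension `i`, i.e. with `i + 1` elements. -/
def facesOfDim {V : Type} (K : FaceComplex V) (i : ℤ) : Finset (Finset V) :=
  K.faces.filter fun σ => (σ.card : ℤ) = i + 1

/-- The coefficient of `τ` in `∂σ`: it is `(-1) ^ j` if `τ` is obtained from
`σ = {v₀ < ⋯ < vᵢ}` by omitting `vⱼ`, and `0` if `τ` is not of this form. -/
def incidence {V : Type} [LinearOrder V] (σ τ : Finset V) : ℤ :=
  ∑ v ∈ σ, if σ.erase v = τ then (-1) ^ (σ.filter (· < v)).card else 0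

section Homology

variable {V : Type} [LinearOrder V] (K : FaceComplex V) (k : Type u) [Field k]
  (G : Type u) [AddCommGroup G] [Module k G]

/-- The component from degree `i` to degree `j` of the boundary of the augmented chain complex with
coefficients in `G`; it vanishes unless `j = i - 1`. A chain of degree `i` is a function from the
`i`-dimensional faces to `G`. -/
def boundary (i j : ℤ) : (K.facesOfDim i → G) →ₗ[k] (K.facesOfDim j → G) :=
  LinearMap.pi fun τ => ∑ σ : K.facesOfDim i, incidence σ.1 τ.1 • LinearMap.proj σ

/-- The component from degree `i` to degree `j` of the differential of the augmented cochain
complex with coefficients in `G`, dual to the boundary: `(δφ)(σ) = φ(∂σ)`; it vanishes unless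
`j = i + 1`. -/
def coboundary (i j : ℤ) : (K.facesOfDim i → G) →ₗ[k] (K.facesOfDim j → G) :=
  LinearMap.pi fun σ => ∑ τ : K.facesOfDim i, incidence σ.1 τ.1 • LinearMap.proj τ

/-- The reduced simplicial homology of `K` in degree `i` with coefficients in `G`. -/
def ReducedHomology (i : ℤ) : Type u :=
  LinearMap.ker (K.boundary k G i (i - 1)) ⧸
    (LinearMap.range (K.boundary k G (i + 1) i)).submoduleOf
      (LinearMap.ker (K.boundary k G i (i - 1)))

/-- The reduced simplicial cohomology of `K` in degree `i` with coefficients in `G`. -/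
def ReducedCohomology (i : ℤ) : Type u :=
  LinearMap.ker (K.coboundary k G i (i + 1)) ⧸
    (LinearMap.range (K.coboundary k G (i - 1) i)).submoduleOf
      (LinearMap.ker (K.coboundary k G i (i + 1)))

instance (i : ℤ) : AddCommGroup (K.ReducedHomology k G i) :=
  inferInstanceAs (AddCommGroup (_ ⧸ _))

instance (i : ℤ) : Module k (K.ReducedHomology k G i) :=
  inferInstanceAs (Module k (_ ⧸ _))

instance (i : ℤ) : AddCommGroup (K.ReducedCohomology k G i) :=
  inferInstanceAs (AddCommGroup (_ ⧸ _))

instance (i : ℤ) : Module k (K.ReducedCohomology k G i) :=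
  inferInstanceAs (Module k (_ ⧸ _))

end Homology

section FaceRing

variable {n : ℕ} (K : FaceComplex (Fin n)) (k : Type u) [Field k]

/-- The ideal of `k[X₁, …, Xₙ]` generated by the squarefree monomials whose support is not a
face. -/
noncomputable def faceIdeal : Ideal (MvPolynomial (Fin n) k) :=
  Ideal.span {p | ∃ s : Finset (Fin n), s ∉ K.faces ∧ p = ∏ v ∈ s, MvPolynomial.X v}

/-- The face ring (Stanley–Reisner ring) `k[K]`. -/
abbrev FaceRing : Type u := MvPolynomial (Fin n) k ⧸ K.faceIdeal k

/-- `Tor_i^R(k[K], k)`, where `R = k[X₁, …, Xₙ]` and `k = R / (X₁, …, Xₙ)`. -/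
noncomputable def torFaceRing (i : ℕ) : ModuleCat.{u} (MvPolynomial (Fin n) k) :=
  ((CategoryTheory.Tor (ModuleCat.{u} (MvPolynomial (Fin n) k)) i).obj
    (ModuleCat.of (MvPolynomial (Fin n) k) (K.FaceRing k))).obj
    (ModuleCat.of (MvPolynomial (Fin n) k)
      (MvPolynomial (Fin n) k ⧸
        Ideal.span (Set.range (MvPolynomial.X : Fin n → MvPolynomial (Fin n) k))))

end FaceRing

end FaceComplex

/-- The depth of a local ring: the supremum of the lengths of the regular sequences in its maximal
ideal. -/
noncomputable def localDepth (A : Type u) [CommRing A] [IsLocalRing A] : ℕ∞ :=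
  ⨆ (rs : List A) (_ : RingTheory.Sequence.IsRegular A rs ∧
    ∀ r ∈ rs, r ∈ IsLocalRing.maximalIdeal A), (rs.length : ℕ∞)

/-- A Cohen–Macaulay ring: it is Noetherian, and its localizations at the maximal ideals have depth
equal to their Krull dimension. -/
def IsCohenMacaulayRing (A : Type u) [CommRing A] : Prop :=
  IsNoetherianRing A ∧ ∀ (P : Ideal A) [P.IsMaximal],
    (localDepth (Localization.AtPrime P) : WithBot ℕ∞) = ringKrullDim (Localization.AtPrime P)

/-!
`Tor_i^R(k[Σ], k)` is the homology of the Koszul complex of `X₁, …, Xₙ` with coefficients in `k[Σ]`,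
because the variables form a regular sequence in `R`. Dividing by squares of variables deforms this
complex onto its part of squarefree multidegree, and the part of multidegree `U ⊆ V` is, up to
signs, the augmented cochain complex of the restriction `Σ_U`, shifted so that `Tor_i` becomes
`H̃^{|U| - i - 1}(Σ_U)`. Removing the vertices outside `U` one at a time, the exact sequence which
compares the cohomology of a complex, of the deletion of a vertex and of the link of this vertex
shows that the restriction to `Σ_U` is bijective on cohomology in this degree as long as all proper
links are acyclic below their top degrees and `i > n - d - 1`. The sum of the groups
`H̃^{j - i - 1}(Σ)` over the `binom(n, j)` sets `U` with `j` elements is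
`H̃^{j - i - 1}(Σ, ⋀^j kⁿ)`. In particular, `Tor_i` vanishes for all `i > n - d - 1` if and only if
`Σ` is acyclic below degree `d`.

By depth sensitivity of the Koszul complex, this vanishing means that the depth of `k[Σ]` at the
origin is at least `d + 1 = dim k[Σ]`. For an arbitrary maximal ideal `P`, the variables outside `P`
form a face `F`, and the localization of `k[Σ]` at `P` is also the localization of the face ring of
the star of `F`, which is a polynomial ring in the variables of `F` over `k[lk F]`. A regular
sequence of length `d + 1 - |F|` in `k[lk F]` is lengthened by one monic polynomial in each variable
of `F`.
-/

/-! ### Koszul complexes and depth -/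

namespace Koszul

open Finset RingTheory.Sequence

lemma sum_sum_erase_eq_zero {ι A : Type*} [DecidableEq ι] [AddCommGroup A] {s : Finset ι}
    {f : ι → ι → A} (hf : ∀ l ∈ s, ∀ m ∈ s, l ≠ m → f l m = -f m l) :
    ∑ l ∈ s, ∑ m ∈ s.erase l, f l m = 0 := by
  rw [sum_sigma']
  refine sum_involution (fun p _ => ⟨p.2, p.1⟩) ?_ ?_ ?_ (fun _ _ => rfl)
  · rintro ⟨l, m⟩ h
    obtain ⟨hl, hml, hm⟩ := by simpa only [mem_sigma, mem_erase] using h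
    rw [hf l hl m hm (Ne.symm hml), neg_add_cancel]
  · rintro ⟨l, m⟩ h _ heq
    simp only [mem_sigma, mem_erase] at h
    exact h.2.1 (Sigma.mk.inj heq).1
  · rintro ⟨l, m⟩ h
    simp only [mem_sigma, mem_erase] at h ⊢
    exact ⟨h.2.2, Ne.symm h.2.1, h.1⟩

section Sign

variable {ι : Type*} [LinearOrder ι]

/-- The sign `(-1) ^ j` of moving `l` past the `j` elements of `T` that precede it. It governs both
the Koszul differential and the simplicial coboundary. -/
def insertSign (l : ι) (T : Finset ι) : ℤ := (-1) ^ #{t ∈ T | t < l}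

lemma insertSign_mul_self (l : ι) (T : Finset ι) : insertSign l T * insertSign l T = 1 := by
  rw [insertSign, ← mul_pow, neg_mul_neg, one_mul, one_pow]

lemma insertSign_smul_insertSign_smul {A : Type*} [AddCommGroup A] (l : ι) (T : Finset ι) (y : A) :
    insertSign l T • insertSign l T • y = y := by
  rw [smul_smul, insertSign_mul_self, one_smul]

lemma insertSign_union {l : ι} {T T' : Finset ι} (h : Disjoint T T') :
    insertSign l (T ∪ T') = insertSign l T * insertSign l T' := by
  rw [insertSign, filter_union, card_union_of_disjoint (disjoint_filter_filter h), pow_add]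
  rfl

lemma insertSign_insert {l m : ι} {T : Finset ι} (hm : m ∉ T) :
    insertSign l (insert m T) = if m < l then -insertSign l T else insertSign l T := by
  rw [insertSign, filter_insert]
  split_ifs
  · rw [card_insert_of_notMem (by simp [hm]), pow_succ, mul_neg_one]
    rfl
  · rfl

lemma insertSign_insert_self (l : ι) (T : Finset ι) :
    insertSign l (insert l T) = insertSign l T := by
  rw [insertSign, filter_insert, if_neg (lt_irrefl l)]
  rfl

lemma insertSign_mul_insertSign_insert {l m : ι} {T : Finset ι} (hlm : l ≠ m) (hl : l ∉ T)
    (hm : m ∉ T) :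
    insertSign l T * insertSign m (insert l T) =
      -(insertSign m T * insertSign l (insert m T)) := by
  rw [insertSign_insert hl, insertSign_insert hm]
  rcases lt_or_gt_of_ne hlm with h | h
  · rw [if_pos h, if_neg h.not_gt]; ring
  · rw [if_neg h.not_gt, if_pos h]; ring

lemma insertSign_insert_mul_insertSign_insert {l m : ι} {T : Finset ι} (hlm : l ≠ m) (hl : l ∉ T)
    (hm : m ∉ T) :
    insertSign l (insert m T) * insertSign m (insert l T) =
      -(insertSign l T * insertSign m T) := by
  rw [insertSign_insert hl, insertSign_insert hm]
  rcases lt_or_gt_of_ne hlm with h | h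
  · rw [if_pos h, if_neg h.not_gt]; ring
  · rw [if_neg h.not_gt, if_pos h]; ring

end Sign

section Component

variable {ι A : Type*} [AddCommGroup A]

/-- The part of degree `i` of a function on finite sets, the degree of a set being its
cardinality. -/
def component (i : ℕ) : (Finset ι → A) →+ (Finset ι → A) where
  toFun φ T := if #T = i then φ T else 0
  map_zero' := funext fun _ => ite_self _
  map_add' φ ψ := by funext T; by_cases h : #T = i <;> simp [h]

lemma component_apply_of_card_eq {i : ℕ} (φ : Finset ι → A) {T : Finset ι} (hT : #T = i) :
    component i φ T = φ T := if_pos hT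

lemma component_apply_of_card_ne {i : ℕ} (φ : Finset ι → A) {T : Finset ι} (hT : #T ≠ i) :
    component i φ T = 0 := if_neg hT

lemma component_eq_component_iff {i : ℕ} {φ ψ : Finset ι → A} :
    component i φ = component i ψ ↔ ∀ T, #T = i → φ T = ψ T := by
  refine ⟨fun h T hT => ?_, fun h => funext fun T => ?_⟩
  · rw [← component_apply_of_card_eq φ hT, h, component_apply_of_card_eq ψ hT]
  · by_cases hT : #T = i
    · rw [component_apply_of_card_eq φ hT, component_apply_of_card_eq ψ hT, h T hT]
    · rw [component_apply_of_card_ne φ hT, component_apply_of_card_ne ψ hT]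

lemma component_component (i : ℕ) (φ : Finset ι → A) :
    component i (component i φ) = component i φ :=
  component_eq_component_iff.mpr fun _ hT => component_apply_of_card_eq φ hT

lemma component_smul {S : Type*} [Semiring S] [Module S A] (i : ℕ) (a : S) (φ : Finset ι → A) :
    component i (a • φ) = a • component i φ := by
  funext T
  by_cases hT : #T = i
  · simp only [component_apply_of_card_eq _ hT, Pi.smul_apply]
  · simp only [component_apply_of_card_ne _ hT, Pi.smul_apply, smul_zero]

end Component

section Reduce

variable {ι S M : Type*} [CommRing S] [AddCommGroup M] [Module S M] {a : S}

variable (ι M a) in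
/-- Reduction modulo `a M` of the values of a chain. -/
def reduce : (Finset ι → M) →ₗ[S] (Finset ι → QuotSMulTop a M) :=
  (Submodule.mkQ _ : M →ₗ[S] QuotSMulTop a M).compLeft (Finset ι)

lemma reduce_surjective : Function.Surjective (reduce ι M a) :=
  (Submodule.mkQ_surjective _).comp_left

lemma reduce_eq_zero_iff {φ : Finset ι → M} : reduce ι M a φ = 0 ↔ ∃ w, φ = a • w := by
  have h (T : Finset ι) : reduce ι M a φ T = 0 ↔ ∃ y, a • y = φ T :=
    (Submodule.Quotient.mk_eq_zero _).trans (by simp [Submodule.mem_smul_pointwise_iff_exists])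
  simp only [funext_iff, Pi.zero_apply, h, Pi.smul_apply, eq_comm (a := φ _)]
  exact Classical.skolem

lemma component_reduce (i : ℕ) (φ : Finset ι → M) :
    component i (reduce ι M a φ) = reduce ι M a (component i φ) :=
  funext fun _ => (apply_ite (Submodule.mkQ _) _ _ _).symm.trans rfl

end Reduce

variable {ι S M : Type*} [LinearOrder ι] [CommRing S] [AddCommGroup M] [Module S M]

section Differential

variable [Fintype ι]

/-- The differential of the Koszul complex of the family `x` with coefficients in `M`, on all
degrees at once: a chain of degree `i` is a function supported on the subsets of `ι` with `i`
elements, its value at `{t₁ < ⋯ < tᵢ}` being the coefficient of `e_{t₁} ∧ ⋯ ∧ e_{tᵢ}`. -/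
def differential (x : ι → S) : (Finset ι → M) →ₗ[S] (Finset ι → M) :=
  LinearMap.pi fun T => ∑ l ∈ Tᶜ, insertSign l T • x l • LinearMap.proj (insert l T)

lemma differential_apply (x : ι → S) (φ : Finset ι → M) (T : Finset ι) :
    differential x φ T = ∑ l ∈ Tᶜ, insertSign l T • x l • φ (insert l T) := by
  simp [differential]

lemma differential_univ (x : ι → S) (φ : Finset ι → M) : differential x φ univ = 0 := by
  rw [differential_apply, compl_univ, sum_empty]

lemma differential_differential (x : ι → S) (φ : Finset ι → M) :
    differential x (differential x φ) = 0 := by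
  funext T
  simp only [differential_apply, smul_sum, Pi.zero_apply, compl_insert]
  refine sum_sum_erase_eq_zero fun l hl m hm hlm => ?_
  simp only [smul_comm (x _) (insertSign _ _), smul_smul (insertSign _ _)]
  rw [insertSign_mul_insertSign_insert hlm (mem_compl.mp hl) (mem_compl.mp hm), neg_smul,
    smul_comm (x l), Finset.insert_comm l m]

lemma component_differential (x : ι → S) (i : ℕ) (φ : Finset ι → M) :
    component i (differential x φ) = differential x (component (i + 1) φ) := by
  funext T
  by_cases hT : #T = i
  · rw [component_apply_of_card_eq _ hT, differential_apply, differential_apply]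
    refine sum_congr rfl fun l hl => ?_
    rw [component_apply_of_card_eq _ (by rw [card_insert_of_notMem (mem_compl.mp hl), hT])]
  · rw [component_apply_of_card_ne _ hT, differential_apply, eq_comm]
    refine sum_eq_zero fun l hl => ?_
    rw [component_apply_of_card_ne _ fun h => hT ?_, smul_zero, smul_zero]
    rwa [card_insert_of_notMem (mem_compl.mp hl), Nat.add_right_cancel_iff] at h

lemma differential_component_eq_zero_iff {x : ι → S} {i : ℕ} {φ : Finset ι → M} :
    differential x (component i φ) = 0 ↔ ∀ T, #T + 1 = i → differential x φ T = 0 := by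
  cases i with
  | zero =>
    refine iff_of_true (funext fun T => ?_) fun T hT => by simp at hT
    rw [differential_apply, Pi.zero_apply]
    refine sum_eq_zero fun l _ => ?_
    rw [component_apply_of_card_ne _ (card_ne_zero.mpr (insert_nonempty l T)), smul_zero, smul_zero]
  | succ j =>
    rw [← component_differential, ← map_zero (component j), component_eq_component_iff]
    simp only [Pi.zero_apply, add_left_inj]

lemma differential_comp {S' M' : Type*} [CommRing S'] [AddCommGroup M'] [Module S' M']
    {x : ι → S} {x' : ι → S'} {f : M →+ M'} (hf : ∀ l y, f (x l • y) = x' l • f y)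
    (φ : Finset ι → M) : differential x' (f ∘ φ) = f ∘ differential x φ := by
  funext T
  simp only [differential_apply, Function.comp_apply, map_sum, map_zsmul, hf]

/-- The Koszul complex of `x` with coefficients in `M` is exact in degree `i`. -/
def IsExactAt (x : ι → S) (M : Type*) [AddCommGroup M] [Module S M] (i : ℕ) : Prop :=
  ∀ φ : Finset ι → M, differential x φ = 0 → ∃ ψ, differential x ψ = component i φ

end Differential

section Homotopy

/-- Exterior multiplication by the basis vector `e_l`, combined with the map `q` on coefficients. -/
def wedge (l : ι) (q : M →+ M) : (Finset ι → M) →+ (Finset ι → M) where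
  toFun φ T := if l ∈ T then insertSign l (T.erase l) • q (φ (T.erase l)) else 0
  map_zero' := by funext T; simp
  map_add' φ ψ := by funext T; by_cases h : l ∈ T <;> simp [h]

lemma wedge_insert {l : ι} (q : M →+ M) (φ : Finset ι → M) {T : Finset ι} (hl : l ∉ T) :
    wedge l q φ (insert l T) = insertSign l T • q (φ T) :=
  (if_pos (mem_insert_self l T)).trans (by rw [erase_insert hl])

lemma wedge_apply_of_notMem {l : ι} (q : M →+ M) (φ : Finset ι → M) {T : Finset ι} (hl : l ∉ T) :
    wedge l q φ T = 0 := if_neg hl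

variable [Fintype ι]

/-- The endomorphism of the Koszul complex which is homotopic to zero by means of `wedge l q`. -/
def wedgeHomotopy (x : ι → S) (l : ι) (q : M →+ M) (φ : Finset ι → M) (T : Finset ι) : M :=
  if l ∈ T then q (x l • φ T) else x l • q (φ T)

lemma differential_wedge_add_wedge_differential {x : ι → S} {l : ι} {q : M →+ M}
    (hq : ∀ m, m ≠ l → ∀ y, q (x m • y) = x m • q y) (φ : Finset ι → M) :
    differential x (wedge l q φ) + wedge l q (differential x φ) = wedgeHomotopy x l q φ := by
  funext T
  rw [Pi.add_apply, wedgeHomotopy]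
  split_ifs with hl
  · obtain ⟨T, hlT, rfl⟩ : ∃ T', l ∉ T' ∧ insert l T' = T :=
      ⟨T.erase l, notMem_erase l T, insert_erase hl⟩
    rw [wedge_insert q _ hlT, differential_apply, differential_apply, compl_insert,
      ← add_sum_erase _ _ (mem_compl.mpr hlT), map_add, smul_add, map_zsmul,
      insertSign_smul_insertSign_smul, map_sum, smul_sum, add_left_comm, ← sum_add_distrib,
      sum_eq_zero, add_zero]
    intro m hm
    obtain ⟨hml, hmT⟩ : m ≠ l ∧ m ∉ T := by simpa using hm
    have hl' : l ∉ insert m T := by simp [hlT, hml.symm]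
    rw [Finset.insert_comm, wedge_insert q _ hl', map_zsmul, hq m hml,
      smul_comm (x m) (insertSign l _), smul_smul, smul_smul, ← add_smul,
      insertSign_insert_mul_insertSign_insert hml hmT hlT, mul_comm (insertSign l T),
      neg_add_cancel, zero_smul]
  · rw [wedge_apply_of_notMem q _ hl, add_zero, differential_apply,
      sum_eq_single_of_mem l (mem_compl.mpr hl), wedge_insert q _ hl, smul_comm (x l),
      insertSign_smul_insertSign_smul]
    intro m _ hml
    rw [wedge_apply_of_notMem q _ (by simp [hl, hml.symm]), smul_zero, smul_zero]

lemma exists_differential_eq_smul {x : ι → S} {φ : Finset ι → M} (hφ : differential x φ = 0) {a : S}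
    (ha : a ∈ Ideal.span (Set.range x)) : ∃ ψ, differential x ψ = a • φ := by
  induction ha using Submodule.span_induction with
  | mem _ h =>
    obtain ⟨l, rfl⟩ := h
    have h := differential_wedge_add_wedge_differential (x := x) (l := l) (q := AddMonoidHom.id M)
      (fun _ _ _ => rfl) φ
    rw [hφ, map_zero, add_zero] at h
    exact ⟨_, h.trans (funext fun T => ite_self _)⟩
  | zero => exact ⟨0, by rw [map_zero, zero_smul]⟩
  | add a b _ _ h₁ h₂ =>
    obtain ⟨ψ₁, h₁⟩ := h₁
    obtain ⟨ψ₂, h₂⟩ := h₂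
    exact ⟨ψ₁ + ψ₂, by rw [map_add, h₁, h₂, add_smul]⟩
  | smul r a _ h =>
    obtain ⟨ψ, h⟩ := h
    exact ⟨r • ψ, by rw [map_smul, h, smul_assoc]⟩

/-- The map `p` is an endomorphism of the Koszul complex chain homotopic to the identity. -/
def IsHomotopicToId (x : ι → S) (p : (Finset ι → M) →+ (Finset ι → M)) : Prop :=
  ∃ w : (Finset ι → M) →+ (Finset ι → M),
    ∀ φ, φ = p φ + (differential x (w φ) + w (differential x φ))

lemma isHomotopicToId_id (x : ι → S) : IsHomotopicToId x (AddMonoidHom.id (Finset ι → M)) :=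
  ⟨0, fun φ => by simp⟩

namespace IsHomotopicToId

variable {x : ι → S} {p p' : (Finset ι → M) →+ (Finset ι → M)}

lemma differential_apply (hp : IsHomotopicToId x p) (φ : Finset ι → M) :
    differential x (p φ) = p (differential x φ) := by
  obtain ⟨w, hw⟩ := hp
  have h₁ := congrArg (differential x) (hw φ)
  have h₂ := hw (differential x φ)
  rw [map_add, map_add, differential_differential, zero_add] at h₁
  rw [differential_differential, map_zero, add_zero] at h₂
  exact add_right_cancel (h₁.symm.trans h₂)

lemma exists_eq_add_differential (hp : IsHomotopicToId x p) {φ : Finset ι → M}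
    (hφ : differential x φ = 0) : ∃ ψ, φ = p φ + differential x ψ := by
  obtain ⟨w, hw⟩ := hp
  have h := hw φ
  rw [hφ, map_zero, add_zero] at h
  exact ⟨w φ, h⟩

lemma comp (hp' : IsHomotopicToId x p') (hp : IsHomotopicToId x p) :
    IsHomotopicToId x (p'.comp p) := by
  obtain ⟨w, hw⟩ := id hp
  obtain ⟨w', hw'⟩ := hp'
  refine ⟨w'.comp p + w, fun φ => ?_⟩
  conv_lhs => rw [hw φ, hw' (p φ), hp.differential_apply]
  simp only [AddMonoidHom.add_apply, AddMonoidHom.comp_apply, map_add]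
  abel

end IsHomotopicToId

lemma exists_isHomotopicToId_eq_sub_wedgeHomotopy {x : ι → S} {l : ι} {q : M →+ M}
    (hq : ∀ m, m ≠ l → ∀ y, q (x m • y) = x m • q y) :
    ∃ p, IsHomotopicToId x p ∧ ∀ φ, p φ = φ - wedgeHomotopy x l q φ := by
  let d : (Finset ι → M) →+ (Finset ι → M) := (differential x).toAddMonoidHom
  refine ⟨AddMonoidHom.id _ - (d.comp (wedge l q) + (wedge l q).comp d), ⟨wedge l q, fun φ => ?_⟩,
    fun φ => ?_⟩
  · exact (sub_add_cancel φ _).symm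
  · exact congrArg (φ - ·) (differential_wedge_add_wedge_differential hq φ)

/-- Composing the homotopies defined by the maps `q l` for `l ∈ L` deforms the Koszul complex into
the subgroups `N L T` without moving the chains which none of the homotopies affects. -/
lemma exists_isHomotopicToId_mem {x : ι → S} {q : ι → M →+ M}
    {N : Finset ι → Finset ι → AddSubgroup M}
    (hq : ∀ l m, m ≠ l → ∀ y, q l (x m • y) = x m • q l y) (hN : ∀ T y, y ∈ N ∅ T)
    (hN_notMem : ∀ L T l, l ∉ T → ∀ y ∈ N L T, y - x l • q l y ∈ N (insert l L) T)
    (hN_mem : ∀ L T l, l ∈ T → ∀ y ∈ N L T, y - q l (x l • y) ∈ N (insert l L) T)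
    (L : Finset ι) :
    ∃ p, IsHomotopicToId x p ∧ (∀ φ T, p φ T ∈ N L T) ∧
      ∀ φ, (∀ l, wedgeHomotopy x l (q l) φ = 0) → p φ = φ := by
  induction L using Finset.induction_on with
  | empty => exact ⟨_, isHomotopicToId_id x, fun φ T => hN T _, fun _ _ => rfl⟩
  | insert l L _ ih =>
    obtain ⟨p, hp, hmem, hfix⟩ := ih
    obtain ⟨p', hp', heq⟩ := exists_isHomotopicToId_eq_sub_wedgeHomotopy (hq l)
    refine ⟨p'.comp p, hp'.comp hp, fun φ T => ?_, fun φ hφ => ?_⟩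
    · rw [AddMonoidHom.comp_apply, heq, Pi.sub_apply, wedgeHomotopy]
      split_ifs with hl
      · exact hN_mem L T l hl _ (hmem φ T)
      · exact hN_notMem L T l hl _ (hmem φ T)
    · rw [AddMonoidHom.comp_apply, heq, hfix φ hφ, hφ, sub_zero]

end Homotopy

section Quotient

variable [Fintype ι] {x : ι → S} {a : S}

lemma differential_reduce (φ : Finset ι → M) :
    differential x (reduce ι M a φ) = reduce ι M a (differential x φ) :=
  differential_comp (f := (Submodule.mkQ _ : M →ₗ[S] QuotSMulTop a M).toAddMonoidHom)
    (fun _ _ => rfl) φ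

lemma IsExactAt.of_quotSMulTop (ha : a ∈ Ideal.span (Set.range x)) (hreg : IsSMulRegular M a)
    {i : ℕ} (h : IsExactAt x (QuotSMulTop a M) (i + 1)) : IsExactAt x M i := by
  intro φ hφ
  obtain ⟨ψ, hψ⟩ := exists_differential_eq_smul hφ ha
  obtain ⟨u', hu⟩ := h (reduce ι M a ψ) <| by
    rw [differential_reduce, hψ, reduce_eq_zero_iff]
    exact ⟨φ, rfl⟩
  obtain ⟨u, rfl⟩ := reduce_surjective u'
  rw [differential_reduce, component_reduce, ← sub_eq_zero, ← map_sub, reduce_eq_zero_iff] at hu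
  obtain ⟨w, hw⟩ := hu
  have h := congrArg (differential x) hw
  rw [map_sub, differential_differential, zero_sub, ← component_differential, hψ, component_smul,
    map_smul, neg_eq_iff_eq_neg, ← smul_neg] at h
  refine ⟨-w, funext fun T => hreg ?_⟩
  rw [map_neg]
  exact (congrFun h T).symm

lemma IsExactAt.quotSMulTop (hreg : IsSMulRegular M a) {i : ℕ} (h : IsExactAt x M i)
    (h' : IsExactAt x M (i + 1)) : IsExactAt x (QuotSMulTop a M) (i + 1) := by
  intro φ' hφ
  obtain ⟨φ, rfl⟩ := reduce_surjective φ'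
  rw [differential_reduce, reduce_eq_zero_iff] at hφ
  obtain ⟨z, hz⟩ := hφ
  obtain ⟨w, hw⟩ := h z <| funext fun T => hreg <| by
    have h := congrArg (differential x) hz
    rw [differential_differential, map_smul] at h
    exact (congrFun h T).symm.trans (smul_zero a).symm
  obtain ⟨v, hv⟩ := h' (component (i + 1) φ - a • w) <| by
    rw [map_sub, map_smul, ← component_differential, hz, hw, component_smul, sub_self]
  have hsub : component (i + 1) (component (i + 1) φ - a • w) - component (i + 1) φ =
      a • -component (i + 1) w := by
    rw [map_sub, component_component, component_smul, sub_sub_cancel_left, smul_neg]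
  refine ⟨reduce ι M a v, ?_⟩
  rw [differential_reduce, hv, component_reduce, ← sub_eq_zero, ← map_sub, hsub]
  exact reduce_eq_zero_iff.mpr ⟨_, rfl⟩

end Quotient

lemma isExactAt_of_isWeaklyRegular [Fintype ι] {x : ι → S} {rs : List S}
    (hrs : ∀ r ∈ rs, r ∈ Ideal.span (Set.range x)) (hreg : IsWeaklyRegular M rs) {i : ℕ}
    (hi : Fintype.card ι < i + rs.length) : IsExactAt x M i := by
  induction rs generalizing M i with
  | nil =>
    refine fun φ _ => ⟨0, funext fun T => ?_⟩
    have hT : #T ≠ i := (T.card_le_univ.trans_lt hi).ne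
    rw [map_zero, component_apply_of_card_ne φ hT, Pi.zero_apply]
  | cons r rs ih =>
    rw [isWeaklyRegular_cons_iff] at hreg
    rw [List.forall_mem_cons] at hrs
    rw [List.length_cons, add_comm rs.length, ← add_assoc] at hi
    exact .of_quotSMulTop hrs.1 hreg.1 (ih hrs.2 hreg.2 hi)

section Noetherian

variable [IsNoetherianRing S]

lemma exists_isSMulRegular_of_forall_smul_eq_zero [Module.Finite S M] {I : Ideal S}
    (h : ∀ y : M, (∀ a ∈ I, a • y = 0) → y = 0) : ∃ a ∈ I, IsSMulRegular M a := by
  have hnot : ¬ (I : Set S) ⊆ ⋃ p ∈ associatedPrimes S M, (p : Set S) := by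
    intro hsub
    obtain ⟨p, hp, hle⟩ := (Ideal.subset_union_prime_finite (associatedPrimes.finite S M)
      (f := id) ⊥ ⊥ (fun p hp _ _ => IsAssociatedPrime.isPrime hp)).mp hsub
    obtain ⟨hprime, y, hy⟩ := isAssociatedPrime_iff.mp hp
    have hy0 : y = 0 := h y fun a ha => by
      simpa [hy] using (hle ha : a ∈ p)
    exact hprime.ne_top (by rw [hy, hy0, Ideal.eq_top_iff_one]; simp)
  obtain ⟨a, haI, ha⟩ := Set.not_subset.mp hnot
  rw [biUnion_associatedPrimes_eq_zero_divisors] at ha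
  refine ⟨a, haI, isSMulRegular_iff_right_eq_zero_of_smul.mpr fun y hy => ?_⟩
  by_contra hne
  exact ha ⟨y, hne, hy⟩

/-- The sequence is built from the right: the vanishing of the Koszul homology in degree `card ι`
says that no nonzero element of `M` is annihilated by `x`. -/
lemma exists_isWeaklyRegular [Fintype ι] {x : ι → S} {r : ℕ} (hr : r ≤ Fintype.card ι)
    [Module.Finite S M] (h : ∀ i, Fintype.card ι < i + r → IsExactAt x M i) :
    ∃ rs : List S, rs.length = r ∧ (∀ a ∈ rs, a ∈ Ideal.span (Set.range x)) ∧
      IsWeaklyRegular M rs := by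
  induction r generalizing M with
  | zero => exact ⟨[], by simp⟩
  | succ r ih =>
    obtain ⟨a, ha, hreg⟩ := exists_isSMulRegular_of_forall_smul_eq_zero
        (M := M) (I := Ideal.span (Set.range x)) fun y hy => by
      obtain ⟨ψ, hψ⟩ := h (Fintype.card ι) (by lia) (fun _ => y) <| by
        funext T
        rw [differential_apply]
        exact sum_eq_zero fun l _ => by rw [hy _ (Ideal.subset_span ⟨l, rfl⟩), smul_zero]
      rw [← component_apply_of_card_eq (fun _ => y) (card_univ (α := ι)), ← hψ, differential_univ]
    obtain ⟨rs, hlen, hmem, hrs⟩ := ih (M := QuotSMulTop a M) (by lia) fun i hi => by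
      obtain ⟨i, rfl⟩ : ∃ j, i = j + 1 := ⟨i - 1, by lia⟩
      exact .quotSMulTop hreg (h i (by lia)) (h (i + 1) (by lia))
    exact ⟨a :: rs, by simp [hlen], by simpa [ha] using hmem, IsWeaklyRegular.cons hreg hrs⟩

end Noetherian

end Koszul

/-! ### Cochains of complexes, deletions and links -/

namespace FaceCochain

open Finset Koszul

section Coboundary

variable {V : Type*} [LinearOrder V] {A : Type*} [AddCommGroup A]

/-- The coboundary of the simplex on `V`, on all degrees at once: a cochain of degree `m - 1` is a
function on the subsets of `V` with `m` elements. -/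
def coboundary : (Finset V → A) →+ (Finset V → A) where
  toFun ψ F := ∑ l ∈ F, insertSign l F • ψ (F.erase l)
  map_zero' := by funext F; simp
  map_add' ψ χ := by funext F; simp [sum_add_distrib]

lemma coboundary_apply (ψ : Finset V → A) (F : Finset V) :
    coboundary ψ F = ∑ l ∈ F, insertSign l F • ψ (F.erase l) := rfl

lemma coboundary_congr {ψ χ : Finset V → A} {F : Finset V}
    (h : ∀ l ∈ F, ψ (F.erase l) = χ (F.erase l)) : coboundary ψ F = coboundary χ F :=
  sum_congr rfl fun l hl => by rw [h l hl]

lemma coboundary_comp {B : Type*} [AddCommGroup B] (f : A →+ B) (ψ : Finset V → A) :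
    coboundary (f ∘ ψ) = f ∘ coboundary ψ := by
  funext F
  simp only [coboundary_apply, Function.comp_apply, map_sum, map_zsmul]

lemma coboundary_coboundary (ψ : Finset V → A) : coboundary (coboundary ψ) = 0 := by
  funext F
  simp only [coboundary_apply, smul_sum, Pi.zero_apply]
  refine sum_sum_erase_eq_zero fun l hl m hm hlm => ?_
  obtain ⟨T, hlT, hmT, rfl⟩ : ∃ T, l ∉ T ∧ m ∉ T ∧ insert l (insert m T) = F :=
    ⟨(F.erase l).erase m, by simp, by simp, by
      rw [insert_erase (mem_erase.mpr ⟨hlm.symm, hm⟩), insert_erase hl]⟩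
  have h₁ : (insert l (insert m T)).erase l = insert m T := erase_insert (by simp [hlT, hlm])
  have h₂ : (insert l (insert m T)).erase m = insert l T := by
    rw [Finset.insert_comm, erase_insert (by simp [hmT, hlm.symm])]
  rw [h₁, h₂, erase_insert hlT, erase_insert hmT, insertSign_insert_self, Finset.insert_comm l m,
    insertSign_insert_self, insertSign_insert_self, insertSign_insert_self, smul_smul, smul_smul,
    mul_comm, insertSign_mul_insertSign_insert hlm.symm hmT hlT, neg_smul, mul_comm]

/-- The contraction of a cochain with the vertex `v`, a cochain on the link of `v`. -/
def contraction (v : V) (ψ : Finset V → A) (F : Finset V) : A := insertSign v F • ψ (insert v F)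

/-- The cochain supported on the faces containing `v` whose contraction with `v` is `η`. -/
def cone (v : V) (η : Finset V → A) (F : Finset V) : A :=
  if v ∈ F then insertSign v F • η (F.erase v) else 0

lemma cone_of_notMem {v : V} {F : Finset V} (hv : v ∉ F) (η : Finset V → A) : cone v η F = 0 :=
  if_neg hv

lemma contraction_cone {v : V} {F : Finset V} (hv : v ∉ F) (η : Finset V → A) :
    contraction v (cone v η) F = η F := by
  rw [contraction, cone, if_pos (mem_insert_self v F), erase_insert hv, insertSign_insert_self,
    insertSign_smul_insertSign_smul]

lemma coboundary_insert {v : V} {F : Finset V} (hv : v ∉ F) (ψ : Finset V → A) :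
    coboundary ψ (insert v F) = insertSign v F • (ψ F - coboundary (contraction v ψ) F) := by
  rw [coboundary_apply, sum_insert hv, erase_insert hv, smul_sub, insertSign_insert_self,
    sub_eq_add_neg, coboundary_apply, smul_sum, ← sum_neg_distrib]
  congr 1
  refine sum_congr rfl fun l hl => ?_
  obtain ⟨T, hlT, rfl⟩ : ∃ T, l ∉ T ∧ insert l T = F := ⟨F.erase l, by simp, insert_erase hl⟩
  obtain ⟨hvl, hvT⟩ : v ≠ l ∧ v ∉ T := by simpa using hv
  rw [contraction, erase_insert hlT, Finset.insert_comm v l,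
    erase_insert (by simp [hlT, hvl.symm]), insertSign_insert_self, insertSign_insert_self,
    insertSign_insert hvT, insertSign_insert hlT, smul_smul, smul_smul, ← neg_smul]
  congr 1
  rcases lt_or_gt_of_ne hvl with h | h
  · rw [if_pos h, if_neg h.not_gt, mul_right_comm, insertSign_mul_self, one_mul]
  · rw [if_neg h.not_gt, if_pos h, neg_mul, neg_mul, neg_neg, mul_right_comm, insertSign_mul_self,
      one_mul]

lemma coboundary_cone_of_notMem {v : V} {F : Finset V} (hv : v ∉ F) (η : Finset V → A) :
    coboundary (cone v η) F = 0 :=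
  sum_eq_zero fun l _ => by
    rw [cone_of_notMem fun h => hv (mem_of_mem_erase h), smul_zero]

lemma coboundary_cone_insert {v : V} {F : Finset V} (hv : v ∉ F) (η : Finset V → A) :
    coboundary (cone v η) (insert v F) = -(insertSign v F • coboundary η F) := by
  rw [coboundary_insert hv, cone_of_notMem hv, zero_sub, smul_neg,
    coboundary_congr fun l _ => contraction_cone (fun h => hv (mem_of_mem_erase h)) η]

end Coboundary

section Complex

variable {V : Type*}

/-- The faces which contain no element of `D`. -/
def deletion (X : LowerSet (Finset V)) (D : Finset V) : LowerSet (Finset V) where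
  carrier := {F | F ∈ X ∧ Disjoint F D}
  lower' _ _ hle h := ⟨X.lower hle h.1, h.2.mono_left hle⟩

variable {X : LowerSet (Finset V)} {v : V} {F G D : Finset V}

lemma mem_deletion : F ∈ deletion X D ↔ F ∈ X ∧ Disjoint F D := Iff.rfl

lemma mem_deletion_singleton : F ∈ deletion X {v} ↔ F ∈ X ∧ v ∉ F := by
  rw [mem_deletion, disjoint_singleton_right]

lemma deletion_le : deletion X D ≤ X := fun _ hF => hF.1

lemma deletion_empty : deletion X ∅ = X := by
  ext F
  simp [mem_deletion]

variable [DecidableEq V]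

/-- The link of `G`, which is empty if `G` is not a face. -/
def link (X : LowerSet (Finset V)) (G : Finset V) : LowerSet (Finset V) where
  carrier := {F | Disjoint F G ∧ F ∪ G ∈ X}
  lower' _ _ hle h := ⟨h.1.mono_left hle, X.lower (union_subset_union_left hle) h.2⟩

lemma mem_link : F ∈ link X G ↔ Disjoint F G ∧ F ∪ G ∈ X := Iff.rfl

lemma link_empty : link X ∅ = X := by
  ext F
  simp [mem_link]

lemma mem_link_singleton : F ∈ link X {v} ↔ v ∉ F ∧ insert v F ∈ X := by
  rw [mem_link, disjoint_singleton_right, union_comm, singleton_union]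

lemma mem_deletion_of_mem_link_singleton (hF : F ∈ link X {v}) : F ∈ deletion X {v} :=
  have h := mem_link_singleton.mp hF
  mem_deletion_singleton.mpr ⟨X.lower (subset_insert v F) h.2, h.1⟩

lemma link_link {H : Finset V} (hGH : Disjoint H G) : link (link X G) H = link X (H ∪ G) := by
  ext F
  simp only [SetLike.mem_coe, mem_link, disjoint_union_left, disjoint_union_right, union_assoc]
  tauto

lemma link_deletion (hGD : Disjoint G D) : link (deletion X D) G = deletion (link X G) D := by
  ext F
  simp only [SetLike.mem_coe, mem_link, mem_deletion, disjoint_union_left]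
  tauto

lemma link_deletion_of_not_disjoint (hGD : ¬ Disjoint G D) : link (deletion X D) G = ⊥ := by
  ext F
  simp only [SetLike.mem_coe, mem_link, mem_deletion, disjoint_union_left, LowerSet.notMem_bot]
  tauto

lemma deletion_insert : deletion X (insert v D) = deletion (deletion X D) {v} := by
  ext F
  simp only [SetLike.mem_coe, mem_deletion, disjoint_insert_right, disjoint_singleton_right]
  tauto

end Complex

section Restriction

variable {V : Type*} [LinearOrder V] {A : Type*} [AddCommGroup A]
  {X Y : LowerSet (Finset V)} {m : ℕ}

/-- The restriction of `ψ` to the faces of `X` with `m` elements is a cocycle. -/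
def IsCocycleOn (X : LowerSet (Finset V)) (m : ℕ) (ψ : Finset V → A) : Prop :=
  ∀ F ∈ X, #F = m + 1 → coboundary ψ F = 0

/-- The restriction of `ψ` to the faces of `X` with `m` elements is a coboundary. -/
def IsCoboundaryOn (X : LowerSet (Finset V)) (m : ℕ) (ψ : Finset V → A) : Prop :=
  ∃ χ, ∀ F ∈ X, #F = m → coboundary χ F = ψ F

lemma IsCocycleOn.mono {ψ : Finset V → A} (h : IsCocycleOn X m ψ) (hYX : Y ≤ X) :
    IsCocycleOn Y m ψ := fun F hF => h F (hYX hF)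

variable (A) in
/-- The reduced cohomology of `X` with coefficients in `A` vanishes in degree `m - 1`. -/
def Acyclic (X : LowerSet (Finset V)) (m : ℕ) : Prop :=
  ∀ ψ : Finset V → A, IsCocycleOn X m ψ → IsCoboundaryOn X m ψ

variable (A) in
/-- Restriction from `X` to `Y` is injective on reduced cohomology in degree `m - 1`. -/
def ResInjective (X Y : LowerSet (Finset V)) (m : ℕ) : Prop :=
  ∀ ψ : Finset V → A, IsCocycleOn X m ψ → IsCoboundaryOn Y m ψ → IsCoboundaryOn X m ψ

variable (A) in
/-- Every cocycle of degree `m - 1` on `Y` extends to a cocycle on `X`. -/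
def ResSurjective (X Y : LowerSet (Finset V)) (m : ℕ) : Prop :=
  ∀ ψ : Finset V → A, IsCocycleOn Y m ψ →
    ∃ ψ', IsCocycleOn X m ψ' ∧ ∀ F ∈ Y, #F = m → ψ' F = ψ F

lemma acyclic_bot : Acyclic A (⊥ : LowerSet (Finset V)) m :=
  fun _ _ => ⟨0, fun _ hF => absurd hF LowerSet.notMem_bot⟩

lemma Acyclic.of_resSurjective (h : Acyclic A X m) (hYX : Y ≤ X) (hr : ResSurjective A X Y m) :
    Acyclic A Y m := by
  intro ψ hψ
  obtain ⟨ψ', hcocycle, heq⟩ := hr ψ hψ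
  obtain ⟨χ, hχ⟩ := h ψ' hcocycle
  exact ⟨χ, fun F hF hc => (hχ F (hYX hF) hc).trans (heq F hF hc)⟩

/-- This is the surjectivity in the exact cohomology sequence of the pair formed by `X` and the
deletion of `v`, the cohomology of which is that of the link of `v`. -/
lemma resSurjective_deletion_singleton {v : V} (h : Acyclic A (link X {v}) m) :
    ResSurjective A X (deletion X {v}) m := by
  intro ψ hψ
  obtain ⟨η, hη⟩ := h ψ fun F hF => hψ F (mem_deletion_of_mem_link_singleton hF)
  let ψ₀ : Finset V → A := fun F => if v ∈ F then 0 else ψ F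
  have hψ₀ {F : Finset V} (hv : v ∉ F) : ψ₀ F = ψ F := if_neg hv
  have hcontr : contraction v ψ₀ = 0 := funext fun F => by
    rw [contraction, show ψ₀ (insert v F) = 0 from if_pos (mem_insert_self v F), smul_zero,
      Pi.zero_apply]
  refine ⟨ψ₀ + cone v η, fun F hF hc => ?_, fun F hF _ => ?_⟩
  · rw [map_add, Pi.add_apply]
    by_cases hv : v ∈ F
    · obtain ⟨T, hvT, rfl⟩ : ∃ T, v ∉ T ∧ insert v T = F := ⟨F.erase v, by simp, insert_erase hv⟩
      rw [card_insert_of_notMem hvT, Nat.add_right_cancel_iff] at hc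
      rw [coboundary_cone_insert hvT, coboundary_insert hvT, hcontr, map_zero, Pi.zero_apply,
        sub_zero, hψ₀ hvT, hη T (mem_link_singleton.mpr ⟨hvT, hF⟩) hc, add_neg_cancel]
    · rw [coboundary_cone_of_notMem hv, add_zero,
        ← hψ F (mem_deletion_singleton.mpr ⟨hF, hv⟩) hc]
      exact coboundary_congr fun l _ => hψ₀ fun h => hv (mem_of_mem_erase h)
  · have hv := (mem_deletion_singleton.mp hF).2
    rw [Pi.add_apply, cone_of_notMem hv, add_zero, hψ₀ hv]

lemma resInjective_deletion_singleton {v : V} (h : ∀ j, j + 1 = m → Acyclic A (link X {v}) j) :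
    ResInjective A X (deletion X {v}) m := by
  rintro ψ hψ ⟨χ, hχ⟩
  obtain rfl | ⟨j, rfl⟩ : m = 0 ∨ ∃ j, m = j + 1 := by cases m <;> simp
  · refine ⟨χ, fun F hF hc => hχ F (mem_deletion_singleton.mpr ⟨hF, ?_⟩) hc⟩
    rw [card_eq_zero.mp hc]
    exact notMem_empty v
  obtain ⟨η, hη⟩ := h j rfl (contraction v (ψ - coboundary χ)) fun F hF hc => by
    obtain ⟨hv, hFX⟩ := mem_link_singleton.mp hF
    have h := coboundary_insert hv (ψ - coboundary χ)
    rw [map_sub, coboundary_coboundary, sub_zero, hψ _ hFX (by rw [card_insert_of_notMem hv, hc]),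
      Pi.sub_apply, hχ F (mem_deletion_of_mem_link_singleton hF) hc, sub_self, zero_sub, smul_neg,
      eq_comm, neg_eq_zero] at h
    rw [← insertSign_smul_insertSign_smul v F (coboundary _ F), h, smul_zero]
  refine ⟨χ - cone v η, fun F hF hc => ?_⟩
  rw [map_sub, Pi.sub_apply]
  by_cases hv : v ∈ F
  · obtain ⟨T, hvT, rfl⟩ : ∃ T, v ∉ T ∧ insert v T = F := ⟨F.erase v, by simp, insert_erase hv⟩
    rw [card_insert_of_notMem hvT, Nat.add_right_cancel_iff] at hc
    rw [coboundary_cone_insert hvT, hη T (mem_link_singleton.mpr ⟨hvT, hF⟩) hc, contraction,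
      insertSign_smul_insertSign_smul, sub_neg_eq_add, Pi.sub_apply, add_sub_cancel]
  · rw [coboundary_cone_of_notMem hv, sub_zero, hχ F (mem_deletion_singleton.mpr ⟨hF, hv⟩) hc]

end Restriction

section LinksAcyclic

variable {V : Type*} [LinearOrder V] {A : Type*} [AddCommGroup A] {X : LowerSet (Finset V)}

variable (A) in
/-- The links of the non-empty faces are acyclic below the top degree, for a complex `X` all of
whose facets have `c` elements. -/
def LinksAcyclic (X : LowerSet (Finset V)) (c : ℕ) : Prop :=
  ∀ (G : Finset V) (m : ℕ), G.Nonempty → m + #G < c → Acyclic A (link X G) m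

namespace LinksAcyclic

variable {c : ℕ}

lemma deletion_singleton (h : LinksAcyclic A X c) (v : V) :
    LinksAcyclic A (deletion X {v}) (c - 1) := by
  intro G m hG hm
  by_cases hv : v ∈ G
  · rw [link_deletion_of_not_disjoint (by simpa using hv)]
    exact acyclic_bot
  · rw [link_deletion (by simpa using hv)]
    refine (h G m hG (by lia)).of_resSurjective deletion_le (resSurjective_deletion_singleton ?_)
    rw [link_link (by simpa using hv), singleton_union]
    exact h _ m (insert_nonempty v G) (by rw [card_insert_of_notMem hv]; lia)

lemma deletion (h : LinksAcyclic A X c) (D : Finset V) :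
    LinksAcyclic A (deletion X D) (c - #D) := by
  induction D using Finset.induction_on with
  | empty => rwa [deletion_empty]
  | insert v D hv ih =>
    rw [deletion_insert, card_insert_of_notMem hv, ← Nat.sub_sub]
    exact ih.deletion_singleton v

lemma acyclic_link_singleton_deletion (h : LinksAcyclic A X c) {v : V} {D : Finset V} {m : ℕ}
    (hm : m + #D + 1 < c) : Acyclic A (link (FaceCochain.deletion X D) {v}) m :=
  h.deletion D {v} m (singleton_nonempty v) (by rw [card_singleton]; lia)

lemma resSurjective (h : LinksAcyclic A X c) {D : Finset V} {m : ℕ} (hm : m + #D < c) :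
    ResSurjective A X (FaceCochain.deletion X D) m := by
  induction D using Finset.induction_on with
  | empty =>
    rw [deletion_empty]
    exact fun ψ hψ => ⟨ψ, hψ, fun _ _ _ => rfl⟩
  | insert v D hv ih =>
    rw [card_insert_of_notMem hv, ← add_assoc] at hm
    rw [deletion_insert]
    intro ψ hψ
    obtain ⟨ψ', hcocycle', heq'⟩ := resSurjective_deletion_singleton
      (h.acyclic_link_singleton_deletion hm) ψ hψ
    obtain ⟨ψ'', hcocycle, heq⟩ := ih (Nat.lt_of_succ_lt hm) ψ' hcocycle'
    exact ⟨ψ'', hcocycle, fun F hF hc => (heq F (deletion_le hF) hc).trans (heq' F hF hc)⟩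

lemma resInjective (h : LinksAcyclic A X c) {D : Finset V} {m : ℕ} (hm : m + #D ≤ c) :
    ResInjective A X (FaceCochain.deletion X D) m := by
  induction D using Finset.induction_on with
  | empty =>
    rw [deletion_empty]
    exact fun _ _ h => h
  | insert v D hv ih =>
    rw [card_insert_of_notMem hv] at hm
    rw [deletion_insert]
    intro ψ hψ hr
    exact ih (by lia) ψ hψ <| resInjective_deletion_singleton
      (fun j hj => h.acyclic_link_singleton_deletion (by lia)) ψ (hψ.mono deletion_le) hr

end LinksAcyclic

end LinksAcyclic

end FaceCochain

/-! ### The Koszul complex of the face ring -/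

namespace Koszul

open Finset MvPolynomial

section DivVar

variable {σ R : Type*} [CommRing R]

/-- Division by the variable `X l`, discarding the monomials not divisible by the square of `X l`:
it maps each squarefree monomial ideal to itself. -/
noncomputable def divVar (l : σ) : MvPolynomial σ R →+ MvPolynomial σ R where
  toFun p := X l * p.divMonomial (Finsupp.single l 2)
  map_zero' := by rw [zero_divMonomial, mul_zero]
  map_add' p q := by rw [add_divMonomial, mul_add]

lemma divVar_apply (l : σ) (p : MvPolynomial σ R) :
    divVar l p = X l * p.divMonomial (Finsupp.single l 2) := rfl

lemma X_mul_divMonomial_single_of_ne {l m : σ} (hml : m ≠ l) (r : ℕ) (p : MvPolynomial σ R) :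
    (X m * p).divMonomial (Finsupp.single l r) = X m * p.divMonomial (Finsupp.single l r) := by
  classical
  ext a
  have hm : m ∈ (Finsupp.single l r + a).support ↔ m ∈ a.support := by
    simp [hml.symm]
  rw [coeff_divMonomial, coeff_X_mul', coeff_X_mul', coeff_divMonomial]
  refine if_ctx_congr hm (fun hm => ?_) fun _ => rfl
  rw [add_tsub_assoc_of_le (Finsupp.single_le_iff.mpr
    (Nat.one_le_iff_ne_zero.mpr (Finsupp.mem_support_iff.mp hm)))]

lemma divVar_X_mul_of_ne {l m : σ} (hml : m ≠ l) (p : MvPolynomial σ R) :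
    divVar l (X m * p) = X m * divVar l p := by
  rw [divVar_apply, divVar_apply, X_mul_divMonomial_single_of_ne hml, mul_left_comm]

lemma X_mul_divVar (l : σ) (p : MvPolynomial σ R) :
    X l * divVar l p = monomial (Finsupp.single l 2) 1 * p.divMonomial (Finsupp.single l 2) := by
  rw [divVar_apply, ← mul_assoc, ← pow_two, X_pow_eq_monomial]

lemma divVar_X_mul (l : σ) (p : MvPolynomial σ R) :
    divVar l (X l * p) = X l * p.divMonomial (Finsupp.single l 1) := by
  rw [divVar_apply, ← one_add_one_eq_two, Finsupp.single_add, divMonomial_add, X_mul_divMonomial]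

lemma modMonomial_divMonomial_self (p : MvPolynomial σ R) (s : σ →₀ ℕ) :
    (p.modMonomial s).divMonomial s = 0 := by
  ext a
  rw [coeff_divMonomial, coeff_modMonomial_of_le p le_self_add, coeff_zero]

lemma modMonomial_divMonomial_eq_zero {p : MvPolynomial σ R} {t : σ →₀ ℕ}
    (h : p.divMonomial t = 0) (s : σ →₀ ℕ) : (p.modMonomial s).divMonomial t = 0 := by
  ext a
  rw [coeff_divMonomial, coeff_zero]
  by_cases hs : s ≤ t + a
  · exact coeff_modMonomial_of_le p hs
  · rw [coeff_modMonomial_of_not_le p hs, ← coeff_divMonomial, h, coeff_zero]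

lemma coeff_eq_zero_of_divMonomial_eq_zero {p : MvPolynomial σ R} {s a : σ →₀ ℕ}
    (h : p.divMonomial s = 0) (hs : s ≤ a) : coeff a p = 0 := by
  rw [← add_tsub_cancel_of_le hs, ← coeff_divMonomial, h, coeff_zero]

end DivVar

section SquarefreeExponent

variable {ι R : Type*} [CommSemiring R]

/-- The exponent of the squarefree monomial with support `F`. -/
noncomputable def squarefreeExponent (F : Finset ι) : ι →₀ ℕ := Finsupp.indicator F fun _ _ => 1

lemma support_squarefreeExponent (F : Finset ι) : (squarefreeExponent F).support = F := by
  classical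
  ext v
  simp [squarefreeExponent, Finsupp.indicator_apply]

lemma squarefreeExponent_le_iff {F : Finset ι} {a : ι →₀ ℕ} :
    squarefreeExponent F ≤ a ↔ F ⊆ a.support := by
  classical
  simp only [Finsupp.le_def, squarefreeExponent, Finsupp.indicator_apply, Finset.subset_iff,
    Finsupp.mem_support_iff]
  grind

lemma squarefreeExponent_support {a : ι →₀ ℕ} (ha : ∀ v, a v < 2) :
    squarefreeExponent a.support = a := by
  classical
  ext v
  have := ha v
  simp only [squarefreeExponent, Finsupp.indicator_apply, Finsupp.mem_support_iff]
  grind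

lemma squarefreeExponent_insert [DecidableEq ι] {l : ι} {F : Finset ι} (hl : l ∉ F) :
    squarefreeExponent (insert l F) = Finsupp.single l 1 + squarefreeExponent F := by
  ext v
  simp only [squarefreeExponent, Finsupp.indicator_apply, Finsupp.add_apply, Finsupp.single_apply]
  grind

lemma prod_X_eq_monomial_squarefreeExponent (F : Finset ι) :
    ∏ v ∈ F, X v = monomial (squarefreeExponent F) (1 : R) := by
  have h := prod_X_pow (R := R) (fun _ : ι => 1) F
  simp only [pow_one] at h
  exact h

end SquarefreeExponent

section SquarefreeChain

variable {ι : Type*} [LinearOrder ι]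

/-- The sign relating the Koszul differential and the coboundary in the multidegree `U`. -/
def squarefreeSign (F U : Finset ι) : ℤ := ∏ f ∈ F, insertSign f U

lemma squarefreeSign_mul_self (F U : Finset ι) : squarefreeSign F U * squarefreeSign F U = 1 := by
  rw [squarefreeSign, ← prod_mul_distrib]
  exact prod_eq_one fun f _ => insertSign_mul_self f U

lemma insertSign_mul_squarefreeSign {l : ι} {F T : Finset ι} (hl : l ∉ F)
    (h : Disjoint (insert l F) T) :
    insertSign l T * squarefreeSign F (insert l F ∪ T) =
      squarefreeSign (insert l F) (insert l F ∪ T) * insertSign l (insert l F) := by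
  rw [squarefreeSign, squarefreeSign, prod_insert hl, insertSign_union (l := l) h]
  linear_combination (-(insertSign l T * ∏ x ∈ F, insertSign x (insert l F ∪ T))) *
    insertSign_mul_self l (insert l F)

variable {R : Type*} [CommRing R]

lemma X_mul_squarefree_monomial {l : ι} {F T : Finset ι} (hl : l ∉ F)
    (h : Disjoint (insert l F) T) (c : R) :
    insertSign l T • (X l : MvPolynomial ι R) • monomial (squarefreeExponent F)
        (squarefreeSign F (F ∪ insert l T) • c) =
      monomial (squarefreeExponent (insert l F))
        (squarefreeSign (insert l F) (insert l F ∪ T) • insertSign l (insert l F) • c) := by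
  rw [smul_eq_mul, X, monomial_mul, one_mul, ← squarefreeExponent_insert hl, ← map_zsmul,
    smul_smul, smul_smul, union_insert, ← insert_union, insertSign_mul_squarefreeSign hl h]

/-- The polynomials in which the variables in `L` have exponent at most one, and at most zero if
they are in `T` as well. -/
def boundedPolynomials (R : Type*) [CommRing R] (L T : Finset ι) :
    AddSubgroup (MvPolynomial ι R) where
  carrier := {p | ∀ l ∈ L, p.divMonomial (Finsupp.single l (if l ∈ T then 1 else 2)) = 0}
  zero_mem' l _ := zero_divMonomial _
  add_mem' hp hq l hl := by rw [add_divMonomial, hp l hl, hq l hl, add_zero]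
  neg_mem' {p} hp l hl := by
    have h := add_divMonomial p (-p) (Finsupp.single l (if l ∈ T then 1 else 2))
    rw [add_neg_cancel, zero_divMonomial, hp l hl, zero_add] at h
    exact h.symm

lemma mem_boundedPolynomials {L T : Finset ι} {p : MvPolynomial ι R} :
    p ∈ boundedPolynomials R L T ↔
      ∀ l ∈ L, p.divMonomial (Finsupp.single l (if l ∈ T then 1 else 2)) = 0 := Iff.rfl

lemma modMonomial_mem_boundedPolynomials {L T : Finset ι} {p : MvPolynomial ι R}
    (hp : p ∈ boundedPolynomials R L T) (l : ι) :
    p.modMonomial (Finsupp.single l (if l ∈ T then 1 else 2)) ∈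
      boundedPolynomials R (insert l L) T := by
  intro m hm
  rcases mem_insert.mp hm with rfl | hm
  · exact modMonomial_divMonomial_self p _
  · exact modMonomial_divMonomial_eq_zero (hp m hm) _

variable [Fintype ι]

/-- The Koszul chain over the polynomial ring formed by a family of cochains `Φ U` of the simplices
with vertex set `U`: the coefficient of `T` is a sum of squarefree monomials with support disjoint
from `T`, and `Φ U` is the component of multidegree `U`. -/
noncomputable def squarefreeChain :
    (Finset ι → Finset ι → R) →ₗ[R] (Finset ι → MvPolynomial ι R) where
  toFun Φ T := ∑ F ∈ Tᶜ.powerset,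
    monomial (squarefreeExponent F) (squarefreeSign F (F ∪ T) • Φ (F ∪ T) F)
  map_add' Φ Ψ := by
    funext T
    simp [sum_add_distrib]
  map_smul' r Φ := by
    funext T
    simp only [Pi.smul_apply, RingHom.id_apply, smul_sum, smul_monomial, smul_comm _ r]

lemma squarefreeChain_apply (Φ : Finset ι → Finset ι → R) (T : Finset ι) :
    squarefreeChain Φ T = ∑ F ∈ Tᶜ.powerset,
      monomial (squarefreeExponent F) (squarefreeSign F (F ∪ T) • Φ (F ∪ T) F) := rfl

lemma coeff_squarefreeChain (Φ : Finset ι → Finset ι → R) (T : Finset ι) (a : ι →₀ ℕ) :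
    coeff a (squarefreeChain Φ T) =
      if squarefreeExponent a.support = a ∧ Disjoint a.support T then
        squarefreeSign a.support (a.support ∪ T) • Φ (a.support ∪ T) a.support
      else 0 := by
  have hmem {F : Finset ι} : F ∈ Tᶜ.powerset ↔ Disjoint F T := by
    rw [mem_powerset, subset_compl_iff_disjoint_right]
  simp only [squarefreeChain_apply, coeff_sum, coeff_monomial]
  split_ifs with ha
  · rw [sum_eq_single_of_mem a.support (hmem.mpr ha.2), if_pos ha.1]
    intro F _ hF
    rw [if_neg fun h => hF (by rw [← h, support_squarefreeExponent])]
  · refine sum_eq_zero fun F hF => if_neg ?_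
    rintro rfl
    exact ha (by rw [support_squarefreeExponent]; exact ⟨rfl, hmem.mp hF⟩)

lemma differential_squarefreeChain (Φ : Finset ι → Finset ι → R) :
    differential (X : ι → MvPolynomial ι R) (squarefreeChain Φ) =
      squarefreeChain fun U => FaceCochain.coboundary (Φ U) := by
  funext T
  simp only [differential_apply, squarefreeChain_apply, FaceCochain.coboundary_apply, smul_sum,
    map_sum]
  rw [sum_sigma', sum_sigma']
  refine sum_bij' (fun p _ => ⟨insert p.1 p.2, p.1⟩) (fun p _ => ⟨p.2, p.1.erase p.2⟩)
    ?_ ?_ ?_ ?_ ?_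
  · rintro ⟨l, F⟩ h
    simp only [mem_sigma, mem_compl, mem_powerset, subset_compl_iff_disjoint_right,
      disjoint_insert_right, disjoint_insert_left] at h ⊢
    exact ⟨⟨h.1, h.2.2⟩, mem_insert_self l F⟩
  · rintro ⟨G, l⟩ h
    simp only [mem_sigma, mem_compl, mem_powerset, subset_compl_iff_disjoint_right,
      disjoint_insert_right] at h ⊢
    exact ⟨disjoint_left.mp h.1 h.2, notMem_erase l G, h.1.mono_left (erase_subset l G)⟩
  · rintro ⟨l, F⟩ h
    simp only [mem_sigma, mem_powerset, subset_compl_iff_disjoint_right, disjoint_insert_right] at h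
    rw [erase_insert h.2.1]
  · rintro ⟨G, l⟩ h
    rw [insert_erase (mem_sigma.mp h).2]
  · rintro ⟨l, F⟩ h
    obtain ⟨hlT, hlF, hFT⟩ : l ∉ T ∧ l ∉ F ∧ Disjoint F T := by
      simp only [mem_sigma, mem_compl, mem_powerset, subset_compl_iff_disjoint_right,
        disjoint_insert_right] at h
      exact ⟨h.1, h.2.1, h.2.2⟩
    rw [X_mul_squarefree_monomial hlF (disjoint_insert_left.mpr ⟨hlT, hFT⟩)]
    dsimp only
    rw [erase_insert hlF, union_insert, ← insert_union]

lemma exists_eq_squarefreeChain {φ : Finset ι → MvPolynomial ι R}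
    (hφ : ∀ T, φ T ∈ boundedPolynomials R univ T) : ∃ Φ, φ = squarefreeChain Φ := by
  refine ⟨fun U F => squarefreeSign F U • coeff (squarefreeExponent F) (φ (U \ F)),
    funext fun T => MvPolynomial.ext _ _ fun a => ?_⟩
  rw [coeff_squarefreeChain]
  have hcoeff {l : ι} (hl : (if l ∈ T then 1 else 2) ≤ a l) : coeff a (φ T) = 0 :=
    coeff_eq_zero_of_divMonomial_eq_zero (hφ T l (mem_univ l)) (Finsupp.single_le_iff.mpr hl)
  split_ifs with ha
  · rw [smul_smul, squarefreeSign_mul_self, one_smul, union_sdiff_cancel_left ha.2, ha.1]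
  · by_contra hne
    refine ha ⟨squarefreeExponent_support fun l => ?_, disjoint_left.mpr fun l hl hlT => ?_⟩
    · by_contra hl
      exact hne (hcoeff (l := l) (by split_ifs <;> lia))
    · exact hne (hcoeff (by rw [if_pos hlT]; exact Nat.one_le_iff_ne_zero.mpr (by simpa using hl)))

lemma squarefreeChain_mem_boundedPolynomials (Φ : Finset ι → Finset ι → R) (T : Finset ι) :
    squarefreeChain Φ T ∈ boundedPolynomials R univ T := by
  intro l _
  ext a
  rw [coeff_divMonomial, coeff_squarefreeChain, coeff_zero, if_neg]
  rintro ⟨hexp, hdisj⟩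
  have hle : (Finsupp.single l (if l ∈ T then 1 else 2) + a : ι →₀ ℕ) l ≤ 1 := by
    rw [← hexp, squarefreeExponent, Finsupp.indicator_apply]
    split_ifs <;> simp
  have hmem : l ∈ _ → l ∉ T := fun h => disjoint_left.mp hdisj h
  simp only [Finsupp.mem_support_iff, Finsupp.add_apply, Finsupp.single_eq_same] at hle hmem
  split_ifs at hle hmem <;> grind

end SquarefreeChain

end Koszul

namespace FaceComplex

open Finset MvPolynomial Koszul FaceCochain

section FaceIdeal

variable {n : ℕ} (K : FaceComplex (Fin n)) (k : Type*) [Field k]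

variable {k} in
lemma mem_faceIdeal_iff {p : MvPolynomial (Fin n) k} :
    p ∈ K.faceIdeal k ↔ ∀ a ∈ p.support, a.support ∉ K.faces := by
  have hspan : K.faceIdeal k = Ideal.span ((fun a => monomial a (1 : k)) ''
      (squarefreeExponent '' {s : Finset (Fin n) | s ∉ K.faces})) := by
    rw [faceIdeal, Set.image_image]
    congr 1
    ext p
    simp [prod_X_eq_monomial_squarefreeExponent, eq_comm]
  rw [hspan, mem_ideal_span_monomial_image]
  refine forall₂_congr fun a _ =>
    ⟨?_, fun h => ⟨_, ⟨_, h, rfl⟩, squarefreeExponent_le_iff.mpr subset_rfl⟩⟩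
  rintro ⟨_, ⟨s, hs, rfl⟩, hle⟩ ha
  exact hs (K.down_closed ha (squarefreeExponent_le_iff.mp hle))

lemma divVar_mem_faceIdeal (l : Fin n) {p : MvPolynomial (Fin n) k} (hp : p ∈ K.faceIdeal k) :
    divVar l p ∈ K.faceIdeal k := by
  rw [mem_faceIdeal_iff] at hp ⊢
  intro b hb
  rw [mem_support_iff, divVar_apply, coeff_X_mul', coeff_divMonomial] at hb
  obtain ⟨hl, hb⟩ := ite_ne_right_iff.mp hb
  have hsupport : (Finsupp.single l 2 + (b - Finsupp.single l 1)).support = b.support := by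
    ext v
    simp only [Finsupp.mem_support_iff, Finsupp.add_apply, Finsupp.tsub_apply,
      Finsupp.single_apply] at hl ⊢
    grind
  exact hsupport ▸ hp _ (mem_support_iff.mpr hb)

/-- The map induced on the face ring by division by a variable. -/
noncomputable def divFace (l : Fin n) : K.FaceRing k →+ K.FaceRing k :=
  QuotientAddGroup.map (K.faceIdeal k).toAddSubgroup (K.faceIdeal k).toAddSubgroup (divVar l)
    fun _ hp => K.divVar_mem_faceIdeal k l hp

variable {k}

lemma divFace_mk (l : Fin n) (p : MvPolynomial (Fin n) k) :
    K.divFace k l (Ideal.Quotient.mk _ p) = Ideal.Quotient.mk _ (divVar l p) := rfl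

lemma smul_mk (p q : MvPolynomial (Fin n) k) :
    p • Ideal.Quotient.mk (K.faceIdeal k) q = Ideal.Quotient.mk _ (p * q) := rfl

lemma divFace_X_smul_of_ne {l m : Fin n} (hml : m ≠ l) (y : K.FaceRing k) :
    K.divFace k l ((X m : MvPolynomial (Fin n) k) • y) =
      (X m : MvPolynomial (Fin n) k) • K.divFace k l y := by
  obtain ⟨p, rfl⟩ := Ideal.Quotient.mk_surjective y
  rw [smul_mk, divFace_mk, divVar_X_mul_of_ne hml, divFace_mk, smul_mk]

lemma sub_X_smul_divFace_mk (l : Fin n) (p : MvPolynomial (Fin n) k) :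
    Ideal.Quotient.mk _ p - (X l : MvPolynomial (Fin n) k) • K.divFace k l (Ideal.Quotient.mk _ p) =
      Ideal.Quotient.mk _ (p.modMonomial (Finsupp.single l 2)) := by
  rw [divFace_mk, smul_mk, X_mul_divVar, ← map_sub, sub_eq_of_eq_add'
    (divMonomial_add_modMonomial p _).symm]

lemma sub_divFace_X_smul_mk (l : Fin n) (p : MvPolynomial (Fin n) k) :
    Ideal.Quotient.mk _ p - K.divFace k l ((X l : MvPolynomial (Fin n) k) •
      Ideal.Quotient.mk _ p) = Ideal.Quotient.mk _ (p.modMonomial (Finsupp.single l 1)) := by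
  rw [smul_mk, divFace_mk, divVar_X_mul, ← map_sub, sub_eq_of_eq_add'
    (divMonomial_add_modMonomial_single p _).symm]

lemma wedgeHomotopy_divFace_mk_eq_zero {φ : Finset (Fin n) → MvPolynomial (Fin n) k}
    (hφ : ∀ T, φ T ∈ boundedPolynomials k univ T) (l : Fin n) :
    wedgeHomotopy (X : Fin n → MvPolynomial (Fin n) k) l (K.divFace k l)
      (Ideal.Quotient.mk _ ∘ φ) = 0 := by
  funext T
  have h := hφ T l (mem_univ l)
  rw [wedgeHomotopy, Function.comp_apply, smul_mk, divFace_mk, divFace_mk, smul_mk]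
  split_ifs at h ⊢
  · rw [divVar_X_mul, h, mul_zero, map_zero, Pi.zero_apply]
  · rw [divVar_apply, h, mul_zero, mul_zero, map_zero, Pi.zero_apply]

end FaceIdeal

section SquarefreeChain

variable {n : ℕ} (K : FaceComplex (Fin n)) (k : Type*) [Field k]

/-- The Koszul chain over the face ring formed by a family of cochains `Φ U` of the simplices with
vertex set `U`. -/
noncomputable def squarefreeChain :
    (Finset (Fin n) → Finset (Fin n) → k) →ₗ[k] (Finset (Fin n) → K.FaceRing k) :=
  (Ideal.Quotient.mkₐ k (K.faceIdeal k)).toLinearMap.compLeft _ ∘ₗ Koszul.squarefreeChain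

variable {k} {Φ Ψ : Finset (Fin n) → Finset (Fin n) → k} {i : ℕ}

lemma squarefreeChain_eq_comp (Φ : Finset (Fin n) → Finset (Fin n) → k) :
    K.squarefreeChain k Φ = Ideal.Quotient.mk _ ∘ Koszul.squarefreeChain Φ := rfl

lemma differential_squarefreeChain (Φ : Finset (Fin n) → Finset (Fin n) → k) :
    differential (X : Fin n → MvPolynomial (Fin n) k) (K.squarefreeChain k Φ) =
      K.squarefreeChain k fun U => FaceCochain.coboundary (Φ U) := by
  rw [squarefreeChain_eq_comp, squarefreeChain_eq_comp, ← Koszul.differential_squarefreeChain]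
  exact differential_comp (f := (Ideal.Quotient.mk (K.faceIdeal k)).toAddMonoidHom)
    (fun l p => rfl) _

lemma squarefreeChain_apply_eq_zero_iff {T : Finset (Fin n)} :
    K.squarefreeChain k Φ T = 0 ↔ ∀ F ∈ K.faces, Disjoint F T → Φ (F ∪ T) F = 0 := by
  have hsmul (F : Finset (Fin n)) : squarefreeSign F (F ∪ T) • Φ (F ∪ T) F = 0 ↔
      Φ (F ∪ T) F = 0 := by
    refine ⟨fun h => ?_, fun h => by rw [h, smul_zero]⟩
    rw [← one_smul ℤ (Φ _ F), ← squarefreeSign_mul_self F (F ∪ T), mul_smul, h, smul_zero]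
  rw [squarefreeChain_eq_comp, Function.comp_apply, Ideal.Quotient.eq_zero_iff_mem,
    mem_faceIdeal_iff]
  refine ⟨fun h F hF hFT => ?_, fun h a ha haK => ?_⟩
  · by_contra hne
    refine h (squarefreeExponent F) ?_ (by rwa [support_squarefreeExponent])
    rw [mem_support_iff, coeff_squarefreeChain, support_squarefreeExponent, if_pos ⟨rfl, hFT⟩]
    exact (hsmul F).not.mpr hne
  · rw [mem_support_iff, coeff_squarefreeChain, ite_ne_right_iff, ne_eq, hsmul] at ha
    exact ha.2 (h _ haK ha.1.2)

lemma component_squarefreeChain (i : ℕ) (Φ : Finset (Fin n) → Finset (Fin n) → k) :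
    component i (K.squarefreeChain k Φ) =
      K.squarefreeChain k fun U F => if #F + i = #U then Φ U F else 0 := by
  funext T
  by_cases hT : #T = i
  · rw [component_apply_of_card_eq _ hT, ← sub_eq_zero, ← Pi.sub_apply, ← map_sub,
      squarefreeChain_apply_eq_zero_iff]
    intro F _ hFT
    rw [Pi.sub_apply, Pi.sub_apply, if_pos (by rw [card_union_of_disjoint hFT, hT]), sub_self]
  · rw [component_apply_of_card_ne _ hT, eq_comm, squarefreeChain_apply_eq_zero_iff]
    intro F _ hFT
    exact if_neg (by rw [card_union_of_disjoint hFT]; lia)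

/-- The complex as a lower set of finite sets. -/
def toLowerSet {V : Type} (K : FaceComplex V) : LowerSet (Finset V) where
  carrier := {F | F ∈ K.faces}
  lower' _ _ hle hF := K.down_closed hF hle

lemma mem_deletion_compl {U F : Finset (Fin n)} :
    F ∈ deletion K.toLowerSet Uᶜ ↔ F ∈ K.faces ∧ F ⊆ U := by
  rw [mem_deletion, ← subset_compl_iff_disjoint_right, compl_compl]
  rfl

lemma forall_squarefreeChain_apply_eq_zero_iff :
    (∀ T, #T = i → K.squarefreeChain k Φ T = 0) ↔
      ∀ U, ∀ F ∈ deletion K.toLowerSet Uᶜ, #F + i = #U → Φ U F = 0 := by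
  simp only [squarefreeChain_apply_eq_zero_iff, mem_deletion_compl]
  refine ⟨fun h U F hF hcard => ?_, fun h T hT F hF hFT => ?_⟩
  · have := card_sdiff_add_card_eq_card hF.2
    simpa only [union_sdiff_of_subset hF.2] using h (U \ F) (by lia) F hF.1 disjoint_sdiff
  · exact h (F ∪ T) F ⟨hF, subset_union_left⟩ (by rw [card_union_of_disjoint hFT, hT])

lemma component_squarefreeChain_eq_iff :
    component i (K.squarefreeChain k Φ) = component i (K.squarefreeChain k Ψ) ↔
      ∀ U, ∀ F ∈ deletion K.toLowerSet Uᶜ, #F + i = #U → Φ U F = Ψ U F := by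
  have h := K.forall_squarefreeChain_apply_eq_zero_iff (Φ := Φ - Ψ) (i := i)
  simpa only [component_eq_component_iff, map_sub, Pi.sub_apply, sub_eq_zero] using h

lemma differential_component_squarefreeChain_eq_zero_iff :
    differential (X : Fin n → MvPolynomial (Fin n) k) (component i (K.squarefreeChain k Φ)) = 0 ↔
      ∀ U, i ≤ #U → IsCocycleOn (deletion K.toLowerSet Uᶜ) (#U - i) (Φ U) := by
  rw [differential_component_eq_zero_iff, differential_squarefreeChain]
  cases i with
  | zero =>
    refine iff_of_true (fun T hT => by simp at hT) fun U _ F hF hcard => ?_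
    have := card_le_card (K.mem_deletion_compl.mp hF).2
    lia
  | succ j =>
    simp only [add_left_inj, forall_squarefreeChain_apply_eq_zero_iff]
    refine forall_congr' fun U =>
      ⟨fun h hU F hF hcard => h F hF (by lia), fun h F hF hcard => ?_⟩
    rcases F.eq_empty_or_nonempty with rfl | hne
    · rfl
    · have := hne.card_pos
      exact h (by lia) F hF (by lia)

variable (k) in
/-- Dividing by squares of variables deforms the Koszul complex of the face ring onto its part of
squarefree multidegree. -/
lemma exists_isHomotopicToId_squarefreeChain :
    ∃ p, IsHomotopicToId (M := K.FaceRing k) (X : Fin n → MvPolynomial (Fin n) k) p ∧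
      (∀ φ, ∃ Φ, p φ = K.squarefreeChain k Φ) ∧
      ∀ Φ, p (K.squarefreeChain k Φ) = K.squarefreeChain k Φ := by
  let N (L T : Finset (Fin n)) : AddSubgroup (K.FaceRing k) :=
    (boundedPolynomials k L T).map (Ideal.Quotient.mk (K.faceIdeal k)).toAddMonoidHom
  have hN (T : Finset (Fin n)) (y : K.FaceRing k) : y ∈ N ∅ T := by
    obtain ⟨p, rfl⟩ := Ideal.Quotient.mk_surjective y
    exact ⟨p, by simp [mem_boundedPolynomials], rfl⟩
  have hN_notMem (L T : Finset (Fin n)) (l : Fin n) (hl : l ∉ T) (y : K.FaceRing k)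
      (hy : y ∈ N L T) :
      y - (X l : MvPolynomial (Fin n) k) • K.divFace k l y ∈ N (insert l L) T := by
    obtain ⟨p, hp, rfl⟩ := hy
    have h := modMonomial_mem_boundedPolynomials hp l
    rw [if_neg hl] at h
    exact ⟨_, h, (K.sub_X_smul_divFace_mk l p).symm⟩
  have hN_mem (L T : Finset (Fin n)) (l : Fin n) (hl : l ∈ T) (y : K.FaceRing k)
      (hy : y ∈ N L T) :
      y - K.divFace k l ((X l : MvPolynomial (Fin n) k) • y) ∈ N (insert l L) T := by
    obtain ⟨p, hp, rfl⟩ := hy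
    have h := modMonomial_mem_boundedPolynomials hp l
    rw [if_pos hl] at h
    exact ⟨_, h, (K.sub_divFace_X_smul_mk l p).symm⟩
  obtain ⟨p, hp, hmem, hfix⟩ := exists_isHomotopicToId_mem
    (fun l m hml => K.divFace_X_smul_of_ne hml) hN hN_notMem hN_mem univ
  refine ⟨p, hp, fun φ => ?_, fun Φ => hfix _ (wedgeHomotopy_divFace_mk_eq_zero K
    (squarefreeChain_mem_boundedPolynomials Φ))⟩
  choose P hP hPφ using hmem φ
  obtain ⟨Φ, rfl⟩ := exists_eq_squarefreeChain hP
  exact ⟨Φ, funext fun T => (hPφ T).symm⟩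

lemma exists_differential_eq_component_squarefreeChain_iff :
    (∃ ψ : Finset (Fin n) → K.FaceRing k, differential (X : Fin n → MvPolynomial (Fin n) k) ψ =
        component i (K.squarefreeChain k Φ)) ↔
      ∀ U, i ≤ #U → IsCoboundaryOn (deletion K.toLowerSet Uᶜ) (#U - i) (Φ U) := by
  constructor
  · rintro ⟨ψ, hψ⟩
    obtain ⟨p, hp, hrange, hfix⟩ := K.exists_isHomotopicToId_squarefreeChain k
    obtain ⟨χ, hχ⟩ := hrange ψ
    have h : component i (K.squarefreeChain k fun U => FaceCochain.coboundary (χ U)) =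
        component i (K.squarefreeChain k Φ) := by
      rw [← differential_squarefreeChain, ← hχ, hp.differential_apply, hψ,
        component_squarefreeChain, hfix, ← component_squarefreeChain, component_component]
    exact fun U hU => ⟨χ U, fun F hF hcard =>
      K.component_squarefreeChain_eq_iff.mp h U F hF (by lia)⟩
  · intro h
    choose! χ hχ using h
    refine ⟨component (i + 1) (K.squarefreeChain k χ), ?_⟩
    rw [← component_differential, differential_squarefreeChain, component_squarefreeChain_eq_iff]
    exact fun U F hF hcard => hχ U (by lia) F hF (by lia)

variable (k) in
lemma exists_eq_squarefreeChain_add_differential {φ : Finset (Fin n) → K.FaceRing k}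
    (hφ : differential (X : Fin n → MvPolynomial (Fin n) k) φ = 0) :
    ∃ Φ ψ, φ = K.squarefreeChain k Φ + differential (X : Fin n → MvPolynomial (Fin n) k) ψ := by
  obtain ⟨p, hp, hrange, -⟩ := K.exists_isHomotopicToId_squarefreeChain k
  obtain ⟨Φ, hΦ⟩ := hrange φ
  obtain ⟨ψ, hψ⟩ := hp.exists_eq_add_differential hφ
  exact ⟨Φ, ψ, hΦ ▸ hψ⟩

variable (k) in
lemma isExactAt_iff_acyclic_deletion :
    IsExactAt (X : Fin n → MvPolynomial (Fin n) k) (K.FaceRing k) i ↔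
      ∀ U, i ≤ #U → Acyclic k (deletion K.toLowerSet Uᶜ) (#U - i) := by
  constructor
  · intro h U hU ψ hψ
    have hcycle : differential (X : Fin n → MvPolynomial (Fin n) k)
        (component i (K.squarefreeChain k (Pi.single U ψ))) = 0 := by
      refine K.differential_component_squarefreeChain_eq_zero_iff.mpr fun W _ F hF hcard => ?_
      obtain rfl | hne := eq_or_ne W U
      · rw [Pi.single_eq_same, hψ F hF hcard]
      · rw [Pi.single_eq_of_ne hne, map_zero, Pi.zero_apply]
    obtain ⟨χ, hχ⟩ := h _ hcycle
    rw [component_component] at hχ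
    simpa using K.exists_differential_eq_component_squarefreeChain_iff.mp ⟨χ, hχ⟩ U hU
  · intro h φ hφ
    obtain ⟨Φ, ψ, rfl⟩ := K.exists_eq_squarefreeChain_add_differential k hφ
    rw [map_add, differential_differential, add_zero] at hφ
    obtain ⟨χ, hχ⟩ := K.exists_differential_eq_component_squarefreeChain_iff.mpr fun U hU =>
      h U hU (Φ U) (K.differential_component_squarefreeChain_eq_zero_iff.mp
        (differential_component_eq_zero_iff.mpr fun T _ => congrFun hφ T) U hU)
    exact ⟨χ + component (i + 1) ψ, by rw [map_add, hχ, ← component_differential, ← map_add]⟩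

variable {K}

lemma isExactAt_of_linksAcyclic {c : ℕ} (h : LinksAcyclic k K.toLowerSet c)
    (h₀ : ∀ m < c, Acyclic k K.toLowerSet m) (hi : n < i + c) :
    IsExactAt (X : Fin n → MvPolynomial (Fin n) k) (K.FaceRing k) i := by
  refine (K.isExactAt_iff_acyclic_deletion k).mpr fun U hU => ?_
  have hcard := card_add_card_compl U
  rw [Fintype.card_fin] at hcard
  exact (h₀ _ (by lia)).of_resSurjective deletion_le (h.resSurjective (by lia))

lemma acyclic_of_isExactAt {m : ℕ} (hm : m + i = n)
    (h : IsExactAt (X : Fin n → MvPolynomial (Fin n) k) (K.FaceRing k) i) :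
    Acyclic k K.toLowerSet m := by
  have h := (K.isExactAt_iff_acyclic_deletion k).mp h univ (by rw [card_fin]; lia)
  rwa [compl_univ, deletion_empty, card_fin, show n - i = m by lia] at h

end SquarefreeChain

end FaceComplex

/-! ### Reduced homology and cohomology -/

namespace FaceComplex

open Finset Koszul FaceCochain

section FacesOfDim

variable {V : Type} (K : FaceComplex V) {G : Type*}

lemma mem_facesOfDim {i : ℤ} {F : Finset V} :
    F ∈ K.facesOfDim i ↔ F ∈ K.toLowerSet ∧ (#F : ℤ) = i + 1 := by
  rw [facesOfDim, mem_filter]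
  rfl

lemma surjective_comp_val [Nonempty G] {i : ℤ} :
    Function.Surjective fun ψ : Finset V → G => ψ ∘ (Subtype.val : K.facesOfDim i → Finset V) :=
  Subtype.val_injective.surjective_comp_right

lemma comp_val_eq_comp_val_iff {i : ℤ} {m : ℕ} (hi : i = m - 1) {ψ χ : Finset V → G} :
    ψ ∘ (Subtype.val : K.facesOfDim i → Finset V) = χ ∘ Subtype.val ↔
      ∀ F ∈ K.toLowerSet, #F = m → ψ F = χ F := by
  simp only [funext_iff, Subtype.forall, mem_facesOfDim, Function.comp_apply, and_imp, hi,
    sub_add_cancel, Nat.cast_inj]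

end FacesOfDim

section ReducedCohomology

variable {V : Type} [LinearOrder V] (K : FaceComplex V) {k : Type u} [Field k]
  {G : Type u} [AddCommGroup G] [Module k G]

lemma sum_incidence_smul {i j : ℤ} (hij : j = i + 1) (ψ : Finset V → G) (σ : K.facesOfDim j) :
    ∑ τ : K.facesOfDim i, incidence σ.1 τ.1 • ψ τ = FaceCochain.coboundary ψ σ := by
  have hσ := K.mem_facesOfDim.mp σ.2
  simp only [incidence, sum_smul, FaceCochain.coboundary_apply]
  rw [sum_comm]
  refine sum_congr rfl fun v hv => ?_
  have hmem : σ.1.erase v ∈ K.facesOfDim i :=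
    K.mem_facesOfDim.mpr ⟨K.down_closed hσ.1 (erase_subset _ _),
      by have := card_erase_add_one hv; lia⟩
  rw [Fintype.sum_eq_single ⟨σ.1.erase v, hmem⟩, if_pos rfl, insertSign]
  exact fun τ hτ => by rw [if_neg fun h => hτ (Subtype.ext h.symm), zero_smul]

lemma coboundary_comp_val {i j : ℤ} (hij : j = i + 1) (ψ : Finset V → G) :
    K.coboundary k G i j (ψ ∘ Subtype.val) = FaceCochain.coboundary ψ ∘ Subtype.val := by
  funext σ
  simp [coboundary, ← K.sum_incidence_smul hij]

lemma comp_val_mem_ker_coboundary_iff {i : ℤ} {m : ℕ} (hi : i = m - 1) {ψ : Finset V → G} :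
    ψ ∘ Subtype.val ∈ LinearMap.ker (K.coboundary k G i (i + 1)) ↔
      IsCocycleOn K.toLowerSet m ψ := by
  rw [LinearMap.mem_ker, K.coboundary_comp_val rfl,
    ← Pi.zero_comp, K.comp_val_eq_comp_val_iff (m := m + 1) (by lia)]
  rfl

lemma comp_val_mem_range_coboundary_iff {i : ℤ} {m : ℕ} (hi : i = m - 1) {ψ : Finset V → G} :
    ψ ∘ Subtype.val ∈ LinearMap.range (K.coboundary k G (i - 1) i) ↔
      IsCoboundaryOn K.toLowerSet m ψ := by
  simp only [LinearMap.mem_range, K.surjective_comp_val.exists,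
    K.coboundary_comp_val (sub_add_cancel i 1).symm, K.comp_val_eq_comp_val_iff hi, IsCoboundaryOn]

lemma acyclic_iff_ker_le_range {i : ℤ} {m : ℕ} (hi : i = m - 1) :
    Acyclic G K.toLowerSet m ↔ LinearMap.ker (K.coboundary k G i (i + 1)) ≤
      LinearMap.range (K.coboundary k G (i - 1) i) := by
  simp only [SetLike.le_def, K.surjective_comp_val.forall,
    K.comp_val_mem_ker_coboundary_iff hi, K.comp_val_mem_range_coboundary_iff hi, Acyclic]

lemma coboundary_comp_coboundary {i j l : ℤ} (hij : j = i + 1) (hjl : l = j + 1) :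
    K.coboundary k G j l ∘ₗ K.coboundary k G i j = 0 := by
  refine LinearMap.ext fun c => ?_
  obtain ⟨ψ, rfl⟩ := K.surjective_comp_val c
  rw [LinearMap.comp_apply, K.coboundary_comp_val hij, K.coboundary_comp_val hjl,
    coboundary_coboundary]
  rfl

end ReducedCohomology

section ReducedHomology

variable {k : Type u} [Field k]

lemma subsingleton_ker_quotient_range_iff {A B C : Type*} [AddCommGroup A] [AddCommGroup B]
    [AddCommGroup C] [Module k A] [Module k B] [Module k C] {f : A →ₗ[k] B} {g : B →ₗ[k] C} :
    Subsingleton (LinearMap.ker g ⧸ (LinearMap.range f).submoduleOf (LinearMap.ker g)) ↔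
      LinearMap.ker g ≤ LinearMap.range f := by
  rw [Submodule.Quotient.subsingleton_iff, Submodule.submoduleOf_eq_top]

lemma ker_le_range_iff_rank_add_rank {l m n : Type*} [Fintype m] [Fintype n]
    {B : Matrix m n k} {C : Matrix l m k} (h : C * B = 0) :
    LinearMap.ker C.mulVecLin ≤ LinearMap.range B.mulVecLin ↔
      B.rank + C.rank = Fintype.card m := by
  have hle : LinearMap.range B.mulVecLin ≤ LinearMap.ker C.mulVecLin := by
    rw [LinearMap.range_le_ker_iff, ← Matrix.mulVecLin_mul, h, Matrix.mulVecLin_zero]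
  have hrank := LinearMap.finrank_range_add_finrank_ker C.mulVecLin
  rw [Module.finrank_fintype_fun_eq_card] at hrank
  rw [Matrix.rank, Matrix.rank]
  refine ⟨fun h' => ?_, fun h' => (Submodule.eq_of_le_of_finrank_eq hle (by lia)).ge⟩
  rw [le_antisymm hle h', add_comm, hrank]

lemma ker_transpose_le_range_transpose_iff {l m n : Type*} [Fintype l] [Fintype m] [Fintype n]
    {B : Matrix m n k} {C : Matrix l m k} (h : C * B = 0) :
    LinearMap.ker B.transpose.mulVecLin ≤ LinearMap.range C.transpose.mulVecLin ↔
      LinearMap.ker C.mulVecLin ≤ LinearMap.range B.mulVecLin := by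
  rw [ker_le_range_iff_rank_add_rank h, ker_le_range_iff_rank_add_rank
    (by rw [← Matrix.transpose_mul, h, Matrix.transpose_zero]), Matrix.rank_transpose,
    Matrix.rank_transpose, add_comm]

variable {V : Type} [LinearOrder V] (K : FaceComplex V)

variable (k) in
/-- The matrix of the coboundary from degree `i` to degree `j`, whose transpose is the matrix of
the boundary from degree `j` to degree `i`. -/
def coboundaryMatrix (i j : ℤ) : Matrix (K.facesOfDim j) (K.facesOfDim i) k :=
  Matrix.of fun σ τ => (incidence σ.1 τ.1 : k)

lemma coboundary_eq_mulVecLin (i j : ℤ) :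
    K.coboundary k k i j = (K.coboundaryMatrix k i j).mulVecLin := by
  refine LinearMap.ext fun c => funext fun σ => ?_
  simp [coboundary, coboundaryMatrix, Matrix.mulVec, dotProduct]

lemma boundary_eq_mulVecLin_transpose (i j : ℤ) :
    K.boundary k k i j = (K.coboundaryMatrix k j i).transpose.mulVecLin := by
  refine LinearMap.ext fun c => funext fun τ => ?_
  simp [boundary, coboundaryMatrix, Matrix.vecMul, dotProduct, mul_comm]

lemma coboundaryMatrix_mul_coboundaryMatrix {i j l : ℤ} (hij : j = i + 1) (hjl : l = j + 1) :
    K.coboundaryMatrix k j l * K.coboundaryMatrix k i j = 0 := by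
  have h := K.coboundary_comp_coboundary (k := k) (G := k) hij hjl
  rw [coboundary_eq_mulVecLin, coboundary_eq_mulVecLin, ← Matrix.mulVecLin_mul] at h
  exact Matrix.toLin'.injective (by rw [Matrix.toLin'_apply', h, map_zero])

lemma subsingleton_reducedHomology_iff {i : ℤ} {m : ℕ} (hi : i = m - 1) :
    Subsingleton (K.ReducedHomology k k i) ↔ Acyclic k K.toLowerSet m := by
  rw [K.acyclic_iff_ker_le_range (k := k) hi]
  refine subsingleton_ker_quotient_range_iff.trans ?_
  rw [boundary_eq_mulVecLin_transpose, boundary_eq_mulVecLin_transpose, coboundary_eq_mulVecLin,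
    coboundary_eq_mulVecLin]
  exact ker_transpose_le_range_transpose_iff
    (K.coboundaryMatrix_mul_coboundaryMatrix (sub_add_cancel i 1).symm rfl)

lemma subsingleton_reducedHomology_of_lt {i : ℤ} (hi : i < -1) :
    Subsingleton (K.ReducedHomology k k i) := by
  have : IsEmpty (K.facesOfDim i) := ⟨fun σ => by
    have := (K.mem_facesOfDim.mp σ.2).2
    lia⟩
  refine subsingleton_ker_quotient_range_iff.mpr fun c _ => ?_
  rw [Subsingleton.elim c 0]
  exact zero_mem _

end ReducedHomology

section Links

variable {V : Type} {K : FaceComplex V} {σ : Finset V}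

lemma IsPure.exists_superset_card_eq (hpure : K.IsPure) (hσ : σ ∈ K.faces) :
    ∃ τ ∈ K.faces, σ ⊆ τ ∧ #τ = K.faces.sup card := by
  obtain ⟨τ, hle, hτ⟩ := K.faces.finite_toSet.exists_le_maximal hσ
  obtain ⟨ρ, hρ, hcard⟩ := exists_mem_eq_sup K.faces ⟨_, hσ⟩ card
  refine ⟨τ, hτ.prop, hle, ?_⟩
  rw [hcard]
  refine hpure τ ρ hτ ⟨hρ, fun F hF hle' => ?_⟩
  rw [← Finset.eq_of_subset_of_card_le hle' (hcard ▸ le_sup (f := card) hF)]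

variable [LinearOrder V]

lemma toLowerSet_link (hσ : σ ∈ K.faces) :
    (K.link σ hσ).toLowerSet = FaceCochain.link K.toLowerSet σ := by
  ext F
  change F ∈ K.faces.filter _ ↔ Disjoint F σ ∧ F ∪ σ ∈ K.faces
  rw [mem_filter, disjoint_comm, union_comm σ F]
  exact ⟨fun h => h.2, fun h => ⟨K.down_closed h.2 subset_union_left, h⟩⟩

lemma IsPure.dim_sub_card_le_dim_link (hpure : K.IsPure) (hσ : σ ∈ K.faces) :
    K.dim - #σ ≤ (K.link σ hσ).dim := by
  obtain ⟨τ, hτ, hle, hcard⟩ := hpure.exists_superset_card_eq hσ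
  have hmem : τ \ σ ∈ (K.link σ hσ).faces :=
    mem_filter.mpr ⟨K.down_closed hτ sdiff_subset, disjoint_sdiff,
      by rwa [union_sdiff_of_subset hle]⟩
  have hsup := le_sup (f := card) hmem
  have hsdiff := card_sdiff_add_card_eq_card hle
  rw [dim, dim]
  lia

lemma IsPure.linksAcyclic {k : Type u} [Field k] (hpure : K.IsPure)
    (hlink : ∀ (σ : Finset V) (hσ : σ ∈ K.faces), σ.Nonempty →
      ∀ i : ℤ, i < (K.link σ hσ).dim → Subsingleton ((K.link σ hσ).ReducedHomology k k i)) :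
    LinksAcyclic k K.toLowerSet (K.faces.sup card) := by
  intro G m hG hm
  by_cases hGK : G ∈ K.faces
  · rw [← toLowerSet_link hGK, ← subsingleton_reducedHomology_iff _ (i := m - 1) rfl]
    refine hlink G hGK hG _ (lt_of_lt_of_le ?_ (hpure.dim_sub_card_le_dim_link hGK))
    rw [dim]
    lia
  · have hbot : FaceCochain.link K.toLowerSet G = ⊥ :=
      SetLike.ext fun F => iff_of_false
        (fun hF => hGK (K.down_closed (mem_link.mp hF).2 subset_union_right)) LowerSet.notMem_bot
    rw [hbot]
    exact acyclic_bot

end Links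

end FaceComplex

/-! ### Koszul resolutions and `Tor` -/

section PolynomialRegularSequence

open Polynomial RingTheory.Sequence

lemma isWeaklyRegular_map_ringEquiv {S T : Type*} [CommRing S] [CommRing T] (e : S ≃+* T)
    {rs : List S} (h : IsWeaklyRegular S rs) : IsWeaklyRegular T (rs.map e) :=
  (AddEquiv.isWeaklyRegular_congr (e := e.toAddEquiv) (List.forall₂_map_right_iff.mpr <|
    List.forall₂_same.mpr fun r _ x => map_mul e r x)).mp h

lemma mem_map_C_of_monic_mul_mem {S : Type*} [CommRing S] {I : Ideal S} {g q : S[X]} (hg : g.Monic)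
    (h : g * q ∈ I.map (C : S →+* S[X])) : q ∈ I.map (C : S →+* S[X]) := by
  have hmem (f : S[X]) : f ∈ I.map (C : S →+* S[X]) ↔ f.map (Ideal.Quotient.mk I) = 0 := by
    simp [Ideal.mem_map_C_iff, Polynomial.ext_iff, Ideal.Quotient.eq_zero_iff_mem]
  rw [hmem, Polynomial.map_mul, (hg.map _).mul_right_eq_zero_iff] at h
  exact (hmem q).mpr h

lemma isWeaklyRegular_map_C_append_monic {S : Type*} [CommRing S] {rs : List S}
    (h : IsWeaklyRegular S rs) {g : S[X]} (hg : g.Monic) :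
    IsWeaklyRegular S[X] (rs.map C ++ [g]) := by
  rw [isWeaklyRegular_append_iff, isWeaklyRegular_singleton_iff]
  refine ⟨h.of_flat, isSMulRegular_iff_right_eq_zero_of_smul.mpr fun y hy => ?_⟩
  obtain ⟨q, rfl⟩ := Submodule.mkQ_surjective _ y
  rw [← map_smul] at hy
  have hmem := (Submodule.Quotient.mk_eq_zero _).mp hy
  refine (Submodule.Quotient.mk_eq_zero _).mpr ?_
  rw [Ideal.smul_eq_mul, Ideal.mul_top, ← Ideal.map_ofList] at hmem ⊢
  exact mem_map_C_of_monic_mul_mem hg hmem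

lemma optionEquivRight_symm_C {S α : Type*} [CommRing S] (p : S[X]) :
    (MvPolynomial.optionEquivRight S α).symm (MvPolynomial.C p) =
      aeval (MvPolynomial.X none) p := by
  rw [AlgEquiv.symm_apply_eq, ← aeval_algHom_apply, MvPolynomial.optionEquivRight_X_none]
  simpa using (aeval_algHom_apply
    (IsScalarTower.toAlgHom S S[X] (MvPolynomial α S[X])) X p).symm

lemma optionEquivRight_symm_aeval_X {S α : Type*} [CommRing S] (i : α) (p : S[X]) :
    (MvPolynomial.optionEquivRight S α).symm (aeval (MvPolynomial.X i) (p.map C)) =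
      aeval (MvPolynomial.X (some i)) p := by
  rw [AlgEquiv.symm_apply_eq, ← aeval_algHom_apply, MvPolynomial.optionEquivRight_X_some,
    ← algebraMap_eq, aeval_map_algebraMap]

lemma exists_isWeaklyRegular_mvPolynomial (ι : Type*) [Finite ι] {S : Type*} [CommRing S]
    {rs : List S} (h : IsWeaklyRegular S rs) {g : ι → S[X]} (hg : ∀ i, (g i).Monic) :
    ∃ l : List ι, l.length = Nat.card ι ∧ IsWeaklyRegular (MvPolynomial ι S)
      (rs.map MvPolynomial.C ++ l.map fun i => aeval (MvPolynomial.X i) (g i)) := by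
  induction ι using Finite.induction_empty_option generalizing S with
  | of_equiv e ih =>
    obtain ⟨l, hlen, hreg⟩ := ih h fun i => hg (e i)
    refine ⟨l.map e, by rw [List.length_map, hlen, Nat.card_congr e], ?_⟩
    simpa [Function.comp_def, ← aeval_algHom_apply] using
      isWeaklyRegular_map_ringEquiv (MvPolynomial.renameEquiv S e).toRingEquiv hreg
  | h_empty => exact ⟨[], by simp, by
    rw [List.map_nil, List.append_nil]
    exact h.of_flat⟩
  | @h_option α _ ih =>
    obtain ⟨l, hlen, hreg⟩ := ih (isWeaklyRegular_map_C_append_monic h (hg none))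
      fun i => (hg (some i)).map C
    refine ⟨none :: l.map some, by simp [hlen], ?_⟩
    simpa [Function.comp_def, optionEquivRight_symm_C, optionEquivRight_symm_aeval_X,
      -MvPolynomial.optionEquivRight_symm_apply] using
      isWeaklyRegular_map_ringEquiv (MvPolynomial.optionEquivRight S α).symm.toRingEquiv hreg

end PolynomialRegularSequence

namespace Koszul

open Finset

lemma isExactAt_mvPolynomial {ι : Type*} [LinearOrder ι] [Fintype ι] (S : Type*) [CommRing S]
    {i : ℕ} (hi : 0 < i) :
    IsExactAt (MvPolynomial.X : ι → MvPolynomial ι S) (MvPolynomial ι S) i := by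
  obtain ⟨l, hlen, hreg⟩ := exists_isWeaklyRegular_mvPolynomial ι
    (RingTheory.Sequence.IsWeaklyRegular.nil S S) fun _ => Polynomial.monic_X
  refine isExactAt_of_isWeaklyRegular (fun r hr => ?_) hreg ?_
  · obtain ⟨i, -, rfl⟩ := List.mem_map.mp hr
    exact Ideal.subset_span ⟨i, (Polynomial.aeval_X _).symm⟩
  · simpa [hlen] using hi

section Graded

variable {ι : Type} {S M : Type u}

/-- The Koszul chains of degree `i`. -/
abbrev Chains (ι : Type) (M : Type u) (i : ℕ) : Type u := {T : Finset ι // #T = i} → M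

lemma surjective_comp_val [Nonempty M] {i : ℕ} :
    Function.Surjective fun φ : Finset ι → M => (φ ∘ Subtype.val : Chains ι M i) :=
  Subtype.val_injective.surjective_comp_right

variable [AddCommGroup M]

lemma comp_val_eq_comp_val_iff {i : ℕ} {φ ψ : Finset ι → M} :
    (φ ∘ Subtype.val : Chains ι M i) = ψ ∘ Subtype.val ↔ component i φ = component i ψ := by
  rw [component_eq_component_iff, funext_iff, Subtype.forall]
  rfl

variable [LinearOrder ι] [Fintype ι] [CommRing S] [Module S M] (x : ι → S) {i : ℕ}

/-- The Koszul differential from degree `i + 1` to degree `i`. -/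
def gradedDifferential (M : Type u) [AddCommGroup M] [Module S M] (i : ℕ) :
    Chains ι M (i + 1) →ₗ[S] Chains ι M i :=
  LinearMap.pi fun T => ∑ l : ↥T.1ᶜ, insertSign l.1 T.1 • x l • LinearMap.proj
    ⟨insert l.1 T.1, by rw [card_insert_of_notMem (mem_compl.mp l.2), T.2]⟩

lemma gradedDifferential_comp_val (φ : Finset ι → M) :
    gradedDifferential x M i (φ ∘ Subtype.val) = differential x φ ∘ Subtype.val := by
  funext T
  simp [gradedDifferential, differential_apply,
    sum_attach T.1ᶜ fun l => insertSign l T.1 • x l • φ (insert l T.1)]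

lemma gradedDifferential_comp_gradedDifferential :
    gradedDifferential x M i ∘ₗ gradedDifferential x M (i + 1) = 0 := by
  refine LinearMap.ext fun φ => ?_
  obtain ⟨φ, rfl⟩ := surjective_comp_val φ
  rw [LinearMap.comp_apply, gradedDifferential_comp_val, gradedDifferential_comp_val,
    differential_differential]
  rfl

variable {x}

lemma comp_val_mem_ker_gradedDifferential_iff {φ : Finset ι → M} :
    φ ∘ Subtype.val ∈ LinearMap.ker (gradedDifferential x M i) ↔
      differential x (component (i + 1) φ) = 0 := by
  rw [LinearMap.mem_ker, gradedDifferential_comp_val, ← component_differential,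
    ← map_zero (component i), ← comp_val_eq_comp_val_iff]
  rfl

lemma comp_val_mem_range_gradedDifferential_iff {φ : Finset ι → M} :
    φ ∘ Subtype.val ∈ LinearMap.range (gradedDifferential x M i) ↔
      ∃ ψ, differential x ψ = component i φ := by
  simp only [LinearMap.mem_range, surjective_comp_val.exists, gradedDifferential_comp_val,
    comp_val_eq_comp_val_iff]
  constructor
  · rintro ⟨ψ, hψ⟩
    exact ⟨component (i + 1) ψ, by rw [← component_differential, hψ]⟩
  · rintro ⟨ψ, hψ⟩
    exact ⟨ψ, by rw [hψ, component_component]⟩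

lemma isExactAt_succ_iff : IsExactAt x M (i + 1) ↔
    LinearMap.ker (gradedDifferential x M i) ≤
      LinearMap.range (gradedDifferential x M (i + 1)) := by
  simp only [SetLike.le_def, surjective_comp_val.forall, comp_val_mem_ker_gradedDifferential_iff,
    comp_val_mem_range_gradedDifferential_iff]
  refine ⟨fun h φ hφ => component_component (i + 1) φ ▸ h _ hφ, fun h φ hφ => h φ ?_⟩
  rw [← component_differential, hφ, map_zero]

end Graded

section Resolution

open CategoryTheory

variable {ι : Type} {S : Type u} [CommRing S] (x : ι → S)

/-- The augmentation of the Koszul complex, whose value at a chain `φ` of degree `0` is the class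
of `φ ∅`. -/
def augmentation : Chains ι S 0 →ₗ[S] S ⧸ Ideal.span (Set.range x) :=
  Submodule.mkQ _ ∘ₗ LinearMap.proj ⟨∅, card_empty⟩

lemma augmentation_surjective : Function.Surjective (augmentation x) :=
  (Submodule.mkQ_surjective _).comp (LinearMap.proj_surjective _)

variable [LinearOrder ι] [Fintype ι]

/-- The Koszul complex of `x`. -/
noncomputable def complex : ChainComplex (ModuleCat.{u} S) ℕ :=
  ChainComplex.of (fun i => ModuleCat.of S (Chains ι S i))
    (fun i => ModuleCat.ofHom (gradedDifferential x S i))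
    fun i => by rw [← ModuleCat.ofHom_comp, gradedDifferential_comp_gradedDifferential]; rfl

lemma complex_d (i : ℕ) : (complex x).d (i + 1) i = ModuleCat.ofHom (gradedDifferential x S i) :=
  ChainComplex.of_d (fun i => ModuleCat.of S (Chains ι S i))
    (fun i => ModuleCat.ofHom (gradedDifferential x S i)) i

lemma exactAt_complex {i : ℕ} (h : IsExactAt x S (i + 1)) : (complex x).ExactAt (i + 1) := by
  rw [HomologicalComplex.exactAt_iff' _ (i + 2) (i + 1) i (by simp) (by simp),
    ShortComplex.moduleCat_exact_iff_ker_sub_range]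
  change LinearMap.ker ((complex x).d (i + 1) i).hom ≤
    LinearMap.range ((complex x).d (i + 2) (i + 1)).hom
  rw [complex_d, complex_d]
  exact isExactAt_succ_iff.mp h

lemma differential_empty (ψ : Finset ι → S) : differential x ψ ∅ = ∑ l, ψ {l} * x l := by
  simp [differential_apply, insertSign, mul_comm]

lemma range_gradedDifferential_zero :
    LinearMap.range (gradedDifferential x S 0) = LinearMap.ker (augmentation x) := by
  ext φ
  obtain ⟨φ, rfl⟩ := surjective_comp_val φ
  rw [LinearMap.mem_ker, augmentation, LinearMap.comp_apply, Submodule.mkQ_apply,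
    Submodule.Quotient.mk_eq_zero, Ideal.mem_span_range_iff_exists_fun,
    comp_val_mem_range_gradedDifferential_iff]
  constructor
  · rintro ⟨ψ, hψ⟩
    exact ⟨fun l => ψ {l}, by rw [← differential_empty, hψ]; rfl⟩
  · rintro ⟨c, hc⟩
    refine ⟨component 1 fun T => ∑ l ∈ T, c l, ?_⟩
    rw [← component_differential, component_eq_component_iff]
    intro T hT
    rw [card_eq_zero.mp hT, differential_empty]
    simpa using hc

/-- The augmentation of the Koszul complex as a map of complexes. -/
noncomputable def toSingle : complex x ⟶ (ChainComplex.single₀ (ModuleCat.{u} S)).obj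
    (ModuleCat.of S (S ⧸ Ideal.span (Set.range x))) :=
  ((complex x).toSingle₀Equiv _).symm ⟨ModuleCat.ofHom (augmentation x), by
    rw [complex_d]
    exact ModuleCat.hom_ext <|
      LinearMap.range_le_ker_iff.mp (range_gradedDifferential_zero x).le⟩

lemma toSingle_f_zero : (toSingle x).f 0 = ModuleCat.ofHom (augmentation x) := by
  exact ChainComplex.toSingle₀Equiv_symm_apply_f_zero _ _

lemma quasiIso_toSingle (h : ∀ i, IsExactAt x S (i + 1)) : QuasiIso (toSingle x) where
  quasiIsoAt i := by
    cases i with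
    | zero =>
      rw [ChainComplex.quasiIsoAt₀_iff, ShortComplex.quasiIso_iff_of_zeros' _ rfl rfl rfl]
      constructor
      · rw [ShortComplex.moduleCat_exact_iff_ker_sub_range]
        change LinearMap.ker ((toSingle x).f 0).hom ≤ LinearMap.range ((complex x).d 1 0).hom
        rw [toSingle_f_zero, complex_d]
        exact (range_gradedDifferential_zero x).ge
      · change Epi ((toSingle x).f 0)
        rw [toSingle_f_zero]
        exact (ModuleCat.epi_iff_surjective (ModuleCat.ofHom (augmentation x))).mpr
          (augmentation_surjective x)
    | succ i =>
      rw [quasiIsoAt_iff_exactAt' (hL := ChainComplex.exactAt_succ_single_obj ..)]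
      exact exactAt_complex x (h i)

/-- The Koszul resolution of `S / (x)`. -/
noncomputable def resolution (h : ∀ i, IsExactAt x S (i + 1)) :
    ProjectiveResolution (ModuleCat.of S (S ⧸ Ideal.span (Set.range x))) where
  complex := complex x
  projective i := ModuleCat.projective_of_free (Pi.basisFun S {T : Finset ι // #T = i})
  π := toSingle x
  quasiIso := quasiIso_toSingle x h

end Resolution

section Tor

open CategoryTheory

variable {ι : Type} [LinearOrder ι] [Fintype ι] {S : Type u} [CommRing S] (x : ι → S)
  (M : Type u) [AddCommGroup M] [Module S M]

/-- The Koszul homology of `M` in degree `i + 1`. -/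
abbrev Homology (i : ℕ) : Type u :=
  LinearMap.ker (gradedDifferential x M i) ⧸
    (LinearMap.range (gradedDifferential x M (i + 1))).submoduleOf
      (LinearMap.ker (gradedDifferential x M i))

variable {x M} in
lemma subsingleton_homology_iff {i : ℕ} :
    Subsingleton (Homology x M i) ↔ IsExactAt x M (i + 1) := by
  rw [Submodule.Quotient.subsingleton_iff, Submodule.submoduleOf_eq_top, isExactAt_succ_iff]

variable {x M} in
lemma smul_homology {p : S} (hp : p ∈ Ideal.span (Set.range x)) {i : ℕ} (z : Homology x M i) :
    p • z = 0 := by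
  obtain ⟨⟨φ, hφ⟩, rfl⟩ := Submodule.mkQ_surjective _ z
  obtain ⟨φ, rfl⟩ := surjective_comp_val φ
  obtain ⟨ψ, hψ⟩ :=
    exists_differential_eq_smul (comp_val_mem_ker_gradedDifferential_iff.mp hφ) hp
  rw [← map_smul, Submodule.mkQ_apply, Submodule.Quotient.mk_eq_zero]
  refine (comp_val_mem_range_gradedDifferential_iff (φ := p • φ)).mpr ⟨ψ, ?_⟩
  rw [hψ, component_smul]

/-- The part of the Koszul complex of `M` around degree `i + 1`. -/
noncomputable def shortComplex (i : ℕ) : ShortComplex (ModuleCat.{u} S) :=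
  ShortComplex.mk (ModuleCat.ofHom (gradedDifferential x M (i + 1)))
    (ModuleCat.ofHom (gradedDifferential x M i)) (by
      rw [← ModuleCat.ofHom_comp, gradedDifferential_comp_gradedDifferential]; rfl)

lemma piScalarRight_lTensor_gradedDifferential (i : ℕ)
    (t : TensorProduct S M (Chains ι S (i + 1))) :
    TensorProduct.piScalarRight S S M _ ((gradedDifferential x S i).lTensor M t) =
      gradedDifferential x M i (TensorProduct.piScalarRight S S M _ t) := by
  suffices h : (TensorProduct.piScalarRight S S M _).toLinearMap ∘ₗ
      (gradedDifferential x S i).lTensor M =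
      gradedDifferential x M i ∘ₗ (TensorProduct.piScalarRight S S M _).toLinearMap from
    LinearMap.congr_fun h t
  refine TensorProduct.ext' fun m φ => funext fun T => ?_
  simp [gradedDifferential, sum_smul, mul_smul, smul_assoc, -zsmul_eq_mul]

/-- The tensor product of `M` with the Koszul complex of `S` is the Koszul complex of `M`. -/
noncomputable def tensorComplexIso (i : ℕ) :
    ((((MonoidalCategory.tensoringLeft (ModuleCat.{u} S)).obj
      (ModuleCat.of S M)).mapHomologicalComplex _).obj (complex x)).sc' (i + 2) (i + 1) i ≅
      shortComplex x M i :=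
  ShortComplex.isoMk
    (TensorProduct.piScalarRight S S M {T : Finset ι // #T = i + 2}).toModuleIso
    (TensorProduct.piScalarRight S S M {T : Finset ι // #T = i + 1}).toModuleIso
    (TensorProduct.piScalarRight S S M {T : Finset ι // #T = i}).toModuleIso
    (by
      change _ = MonoidalCategory.whiskerLeft (ModuleCat.of S M) ((complex x).d (i + 2) (i + 1)) ≫ _
      rw [complex_d]
      refine ModuleCat.hom_ext (LinearMap.ext fun t => ?_)
      exact (piScalarRight_lTensor_gradedDifferential x M (i + 1) t).symm)
    (by
      change _ = MonoidalCategory.whiskerLeft (ModuleCat.of S M) ((complex x).d (i + 1) i) ≫ _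
      rw [complex_d]
      refine ModuleCat.hom_ext (LinearMap.ext fun t => ?_)
      exact (piScalarRight_lTensor_gradedDifferential x M i t).symm)

/-- `Tor` of `M` and `S / (x)` is the Koszul homology of `M`, if the Koszul complex of `S` is
acyclic. -/
noncomputable def torIso (h : ∀ i, IsExactAt x S (i + 1)) (i : ℕ) :
    ((Tor (ModuleCat.{u} S) (i + 1)).obj (ModuleCat.of S M)).obj
      (ModuleCat.of S (S ⧸ Ideal.span (Set.range x))) ≅ ModuleCat.of S (Homology x M i) :=
  (resolution x h).isoLeftDerivedObj
    ((MonoidalCategory.tensoringLeft (ModuleCat.{u} S)).obj (ModuleCat.of S M)) (i + 1) ≪≫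
  HomologicalComplex.homologyIsoSc' _ (i + 2) (i + 1) i (by simp) (by simp) ≪≫
  ShortComplex.homologyMapIso (tensorComplexIso x M i) ≪≫
  (shortComplex x M i).moduleCatHomologyIso ≪≫
  (Submodule.quotEquivOfEq _ _ (by
    ext φ
    change _ ↔ φ.1 ∈ LinearMap.range (gradedDifferential x M (i + 1))
    constructor
    · rintro ⟨ψ, rfl⟩
      exact ⟨ψ, rfl⟩
    · rintro ⟨ψ, hψ⟩
      exact ⟨ψ, Subtype.ext hψ⟩)).toModuleIso

end Tor

end Koszul

/-! ### `Tor` of the face ring -/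

namespace FaceCochain

section Coordinates

variable {V I k G : Type*} [Fintype I] [Field k] [AddCommGroup G] [Module k G]
  (b : Module.Basis I k G)

/-- The cochain with values in `G` whose coordinates in the basis `b` are the `Ψ i`. -/
noncomputable def cochainOfCoords : (I → Finset V → k) →ₗ[k] (Finset V → G) :=
  LinearMap.pi fun F => b.equivFun.symm.toLinearMap ∘ₗ
    LinearMap.pi fun i => LinearMap.proj F ∘ₗ LinearMap.proj i

variable {b} {Ψ Ψ' : I → Finset V → k}

lemma coord_comp_cochainOfCoords (i : I) :
    (b.coord i).toAddMonoidHom ∘ cochainOfCoords b Ψ = Ψ i :=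
  funext fun _ => congrFun (b.equivFun.apply_symm_apply _) i

lemma cochainOfCoords_surjective :
    Function.Surjective (cochainOfCoords b : (I → Finset V → k) →ₗ[k] (Finset V → G)) :=
  fun ψ => ⟨fun i F => b.equivFun (ψ F) i, funext fun F => b.equivFun.symm_apply_apply (ψ F)⟩

lemma cochainOfCoords_apply_eq_iff {F : Finset V} :
    cochainOfCoords b Ψ F = cochainOfCoords b Ψ' F ↔ ∀ i, Ψ i F = Ψ' i F :=
  b.equivFun.symm.injective.eq_iff.trans funext_iff

variable [LinearOrder V] {X : LowerSet (Finset V)} {m : ℕ}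

lemma coboundary_cochainOfCoords :
    coboundary (cochainOfCoords b Ψ) = cochainOfCoords b fun i => coboundary (Ψ i) := by
  funext F
  refine b.ext_elem fun i => ?_
  have h := coboundary_comp (b.coord i).toAddMonoidHom (cochainOfCoords b Ψ)
  rw [coord_comp_cochainOfCoords] at h
  exact (congrFun h F).symm.trans 
    (congrFun (coord_comp_cochainOfCoords (Ψ := fun i => coboundary (Ψ i)) (b := b) i) F).symm

lemma isCocycleOn_cochainOfCoords_iff :
    IsCocycleOn X m (cochainOfCoords b Ψ) ↔ ∀ i, IsCocycleOn X m (Ψ i) := by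
  have hzero (Ψ : I → Finset V → k) (F : Finset V) :
      cochainOfCoords b Ψ F = 0 ↔ ∀ i, Ψ i F = 0 := by
    simpa using cochainOfCoords_apply_eq_iff (b := b) (Ψ := Ψ) (Ψ' := 0) (F := F)
  simp only [IsCocycleOn, coboundary_cochainOfCoords, hzero]
  exact ⟨fun h i F hF hcard => h F hF hcard i, fun h F hF hcard i => h i F hF hcard⟩

lemma isCoboundaryOn_cochainOfCoords_iff :
    IsCoboundaryOn X m (cochainOfCoords b Ψ) ↔ ∀ i, IsCoboundaryOn X m (Ψ i) := by
  simp only [IsCoboundaryOn, (cochainOfCoords_surjective (b := b)).exists,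
    coboundary_cochainOfCoords, cochainOfCoords_apply_eq_iff]
  refine ⟨fun ⟨Χ, hΧ⟩ i => ⟨Χ i, fun F hF hcard => hΧ F hF hcard i⟩, fun h => ?_⟩
  choose Χ hΧ using h
  exact ⟨Χ, fun F hF hcard i => hΧ i F hF hcard⟩

end Coordinates

end FaceCochain

namespace FaceComplex

open MvPolynomial Koszul Finset CategoryTheory FaceCochain

variable {n : ℕ} (K : FaceComplex (Fin n)) (k : Type u) [Field k]

/-- The families of cochains `Ψ U`, indexed by the sets of vertices `U`, such that `Ψ U` is a
cocycle on the faces with `#U - i` elements. -/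
def cocycleFamilies (i : ℕ) : Submodule k (Finset (Fin n) → Finset (Fin n) → k) where
  carrier := {Ψ | ∀ U, i ≤ #U → IsCocycleOn K.toLowerSet (#U - i) (Ψ U)}
  zero_mem' U _ F _ _ := congrFun (map_zero FaceCochain.coboundary) F
  add_mem' {Ψ Ψ'} hΨ hΨ' U hU F hF hcard := by
    rw [Pi.add_apply, map_add, Pi.add_apply, hΨ U hU F hF hcard, hΨ' U hU F hF hcard, add_zero]
  smul_mem' a Ψ hΨ U hU F hF hcard := by
    change FaceCochain.coboundary (AddMonoidHom.mulLeft a ∘ Ψ U) F = 0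
    rw [coboundary_comp, Function.comp_apply, hΨ U hU F hF hcard, map_zero]

section KoszulHomology

variable {K k} {c i : ℕ} {Ψ : Finset (Fin n) → Finset (Fin n) → k}

lemma differential_component_squarefreeChain_eq_zero (hΨ : Ψ ∈ K.cocycleFamilies k i) :
    differential (X : Fin n → MvPolynomial (Fin n) k) (component i (K.squarefreeChain k Ψ)) = 0 :=
  K.differential_component_squarefreeChain_eq_zero_iff.mpr fun U hU =>
    (hΨ U hU).mono deletion_le

lemma exists_mem_cocycleFamilies_component_eq (h : LinksAcyclic k K.toLowerSet c)
    (hi : n < i + c) {φ : Finset (Fin n) → K.FaceRing k}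
    (hφ : differential (X : Fin n → MvPolynomial (Fin n) k) (component i φ) = 0) :
    ∃ Ψ ∈ K.cocycleFamilies k i, ∃ ψ, component i φ = component i (K.squarefreeChain k Ψ) +
      differential (X : Fin n → MvPolynomial (Fin n) k) ψ := by
  obtain ⟨Φ, ψ, hΦ⟩ := K.exists_eq_squarefreeChain_add_differential k hφ
  have hcomponent : component i φ = component i (K.squarefreeChain k Φ) +
      differential (X : Fin n → MvPolynomial (Fin n) k) (component (i + 1) ψ) := by
    rw [← component_differential, ← map_add, ← hΦ, component_component]
  rw [hcomponent, map_add, differential_differential, add_zero,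
    differential_component_squarefreeChain_eq_zero_iff] at hφ
  have hext (U : Finset (Fin n)) (hU : i ≤ #U) :=
    have hcard : #U + #Uᶜ = n := by rw [card_add_card_compl, Fintype.card_fin]
    h.resSurjective (D := Uᶜ) (by lia) (Φ U) (hφ U hU)
  choose! Ψ hΨ hΨΦ using hext
  refine ⟨Ψ, hΨ, _, hcomponent.trans (congrArg (· + _) ?_)⟩
  rw [component_squarefreeChain_eq_iff]
  exact fun U F hF hcard => (hΨΦ U (by lia) F hF (by lia)).symm

lemma exists_differential_eq_iff_isCoboundaryOn (h : LinksAcyclic k K.toLowerSet c)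
    (hi : n < i + c) (hΨ : Ψ ∈ K.cocycleFamilies k i) :
    (∃ ψ, differential (X : Fin n → MvPolynomial (Fin n) k) ψ =
        component i (K.squarefreeChain k Ψ)) ↔
      ∀ U, i ≤ #U → IsCoboundaryOn K.toLowerSet (#U - i) (Ψ U) := by
  rw [exists_differential_eq_component_squarefreeChain_iff]
  refine forall₂_congr fun U hU => ⟨fun hb => ?_, fun ⟨χ, hχ⟩ =>
    ⟨χ, fun F hF => hχ F (deletion_le hF)⟩⟩
  have hcard : #U + #Uᶜ = n := by rw [card_add_card_compl, Fintype.card_fin]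
  exact h.resInjective (by lia) (Ψ U) (hΨ U hU) hb

lemma squarefreeChain_comp_val_mem_ker (hΨ : Ψ ∈ K.cocycleFamilies k (i + 1)) :
    K.squarefreeChain k Ψ ∘ Subtype.val ∈ LinearMap.ker
      (gradedDifferential (X : Fin n → MvPolynomial (Fin n) k) (K.FaceRing k) i) :=
  comp_val_mem_ker_gradedDifferential_iff.mpr (differential_component_squarefreeChain_eq_zero hΨ)

variable (K k) in
/-- The Koszul homology class of the squarefree chain of a family of cocycles. -/
noncomputable def homologyClass (i : ℕ) : K.cocycleFamilies k (i + 1) →ₗ[k]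
    Homology (X : Fin n → MvPolynomial (Fin n) k) (K.FaceRing k) i :=
  (Submodule.mkQ _).restrictScalars k ∘ₗ
    (LinearMap.funLeft k (K.FaceRing k) Subtype.val ∘ₗ K.squarefreeChain k ∘ₗ
      (K.cocycleFamilies k (i + 1)).subtype).codRestrict
    ((LinearMap.ker (gradedDifferential (X : Fin n → MvPolynomial (Fin n) k)
      (K.FaceRing k) i)).restrictScalars k)
    fun Ψ => squarefreeChain_comp_val_mem_ker Ψ.2

lemma homologyClass_surjective (h : LinksAcyclic k K.toLowerSet c) (hi : n < i + 1 + c) :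
    Function.Surjective (K.homologyClass k i) := by
  intro y
  obtain ⟨⟨φ, hφ⟩, rfl⟩ := Submodule.mkQ_surjective _ y
  obtain ⟨φ, rfl⟩ := Koszul.surjective_comp_val φ
  obtain ⟨Ψ, hΨ, ψ, hψ⟩ := exists_mem_cocycleFamilies_component_eq h hi
    (comp_val_mem_ker_gradedDifferential_iff.mp hφ)
  refine ⟨⟨Ψ, hΨ⟩, (Submodule.Quotient.eq _).mpr ?_⟩
  refine comp_val_mem_range_gradedDifferential_iff (φ := K.squarefreeChain k Ψ - φ).mpr ⟨-ψ, ?_⟩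
  rw [map_sub, hψ, map_neg]
  abel

lemma homologyClass_eq_zero_iff (h : LinksAcyclic k K.toLowerSet c) (hi : n < i + 1 + c)
    {Ψ : K.cocycleFamilies k (i + 1)} : K.homologyClass k i Ψ = 0 ↔
      ∀ U, i + 1 ≤ #U → IsCoboundaryOn K.toLowerSet (#U - (i + 1)) (Ψ.1 U) := by
  rw [← exists_differential_eq_iff_isCoboundaryOn h hi Ψ.2,
    ← comp_val_mem_range_gradedDifferential_iff]
  exact Submodule.Quotient.mk_eq_zero _

end KoszulHomology

section ExteriorPower

variable (n) in
/-- The basis of the exterior power of `kⁿ` indexed by the sets with `j` elements. -/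
noncomputable def exteriorBasis (j : ℕ) :
    Module.Basis (Set.powersetCard (Fin n) j) k (⋀[k]^j (Fin n → k)) :=
  (Pi.basisFun k (Fin n)).exteriorPower j

/-- The cochain with values in an exterior power whose coefficient at the basis vector of index `U`
is `Ψ U`. -/
noncomputable def exteriorCochain (j : ℕ) : (Finset (Fin n) → Finset (Fin n) → k) →ₗ[k]
    (Finset (Fin n) → ⋀[k]^j (Fin n → k)) :=
  cochainOfCoords (exteriorBasis n k j) ∘ₗ LinearMap.funLeft k _ Subtype.val

variable {k} {j m : ℕ} {X : LowerSet (Finset (Fin n))} {Ψ : Finset (Fin n) → Finset (Fin n) → k}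

lemma isCocycleOn_exteriorCochain_iff : IsCocycleOn X m (exteriorCochain k j Ψ) ↔
    ∀ U, #U = j → IsCocycleOn X m (Ψ U) :=
  isCocycleOn_cochainOfCoords_iff.trans Subtype.forall

lemma isCoboundaryOn_exteriorCochain_iff : IsCoboundaryOn X m (exteriorCochain k j Ψ) ↔
    ∀ U, #U = j → IsCoboundaryOn X m (Ψ U) :=
  isCoboundaryOn_cochainOfCoords_iff.trans Subtype.forall

lemma exteriorCochain_congr {Ψ' : Finset (Fin n) → Finset (Fin n) → k}
    (h : ∀ U, #U = j → Ψ U = Ψ' U) : exteriorCochain k j Ψ = exteriorCochain k j Ψ' :=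
  congrArg (cochainOfCoords _) (funext fun U => h U U.2)

lemma exteriorCochain_surjective : Function.Surjective (exteriorCochain (n := n) k j) :=
  (cochainOfCoords_surjective (b := exteriorBasis n k j)).comp
    Subtype.val_injective.surjective_comp_right

end ExteriorPower

section Cohomology

lemma isEmpty_facesOfDim {i : ℤ} (hi : i < -1) : IsEmpty (K.facesOfDim i) :=
  ⟨fun F => by have := (K.mem_facesOfDim.mp F.2).2; lia⟩

variable {K k} {i j : ℕ} {G : Type u} [AddCommGroup G] [Module k G] {ψ : Finset (Fin n) → G}

lemma comp_val_mem_ker_coboundary_sub_iff :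
    ψ ∘ Subtype.val ∈ LinearMap.ker (K.coboundary k G ((j : ℤ) - i - 1) ((j : ℤ) - i - 1 + 1)) ↔
      (i ≤ j → IsCocycleOn K.toLowerSet (j - i) ψ) := by
  by_cases hij : i ≤ j
  · rw [K.comp_val_mem_ker_coboundary_iff (m := j - i) (by lia), forall_prop_of_true hij]
  · have := K.isEmpty_facesOfDim (i := (j : ℤ) - i - 1) (by lia)
    exact iff_of_true (by rw [Subsingleton.elim (ψ ∘ Subtype.val) 0]; exact zero_mem _)
      fun h => absurd h hij

lemma comp_val_mem_range_coboundary_sub_iff :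
    ψ ∘ Subtype.val ∈ LinearMap.range
        (K.coboundary k G ((j : ℤ) - i - 1 - 1) ((j : ℤ) - i - 1)) ↔
      (i ≤ j → IsCoboundaryOn K.toLowerSet (j - i) ψ) := by
  by_cases hij : i ≤ j
  · rw [K.comp_val_mem_range_coboundary_iff (m := j - i) (by lia), forall_prop_of_true hij]
  · have := K.isEmpty_facesOfDim (i := (j : ℤ) - i - 1) (by lia)
    exact iff_of_true (by rw [Subsingleton.elim (ψ ∘ Subtype.val) 0]; exact zero_mem _)
      fun h => absurd h hij

variable (K k) in
/-- The cohomology class, with coefficients in the `j`-th exterior power of `kⁿ`, of a family of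
cocycles. -/
noncomputable def cohomologyClass (i j : ℕ) : K.cocycleFamilies k i →ₗ[k]
    K.ReducedCohomology k (⋀[k]^j (Fin n → k)) ((j : ℤ) - i - 1) :=
  (Submodule.mkQ _ :
    LinearMap.ker (K.coboundary k (⋀[k]^j (Fin n → k)) ((j : ℤ) - i - 1) _) →ₗ[k] _) ∘ₗ
  LinearMap.codRestrict _
    (LinearMap.funLeft k _ Subtype.val ∘ₗ exteriorCochain k j ∘ₗ Submodule.subtype _)
    fun Ψ => comp_val_mem_ker_coboundary_sub_iff.mpr fun hij =>
      isCocycleOn_exteriorCochain_iff.mpr fun U hU => hU ▸ Ψ.2 U (hU ▸ hij)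

lemma cohomologyClass_eq_zero_iff {Ψ : K.cocycleFamilies k i} :
    K.cohomologyClass k i j Ψ = 0 ↔
      ∀ U, #U = j → i ≤ #U → IsCoboundaryOn K.toLowerSet (#U - i) (Ψ.1 U) := by
  refine (Submodule.Quotient.mk_eq_zero _).trans
    ((comp_val_mem_range_coboundary_sub_iff (ψ := exteriorCochain k j Ψ.1)).trans ?_)
  rw [isCoboundaryOn_exteriorCochain_iff]
  exact ⟨fun h U hU hij => hU ▸ h (hU ▸ hij) U hU, fun h hij U hU => hU ▸ h U hU (hU ▸ hij)⟩

variable (K k) in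
/-- The cohomology classes of a family of cocycles with coefficients in all exterior powers. -/
noncomputable def cohomologyClasses (i : ℕ) : K.cocycleFamilies k i →ₗ[k]
    ∀ j : Fin (n + 1), K.ReducedCohomology k (⋀[k]^(j : ℕ) (Fin n → k)) ((j : ℤ) - i - 1) :=
  LinearMap.pi fun j => K.cohomologyClass k i j

lemma cohomologyClasses_eq_zero_iff {Ψ : K.cocycleFamilies k i} :
    K.cohomologyClasses k i Ψ = 0 ↔
      ∀ U, i ≤ #U → IsCoboundaryOn K.toLowerSet (#U - i) (Ψ.1 U) := by
  refine (_root_.funext_iff.trans (forall_congr' fun j => cohomologyClass_eq_zero_iff)).trans ?_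
  exact ⟨fun h U => h ⟨#U, Nat.lt_succ_of_le (card_finset_fin_le U)⟩ U rfl, fun h _ U _ => h U⟩

lemma exists_mkQ_exteriorCochain_eq
    (y : K.ReducedCohomology k (⋀[k]^j (Fin n → k)) ((j : ℤ) - i - 1)) :
    ∃ (Ψ : Finset (Fin n) → Finset (Fin n) → k) (hΨ : exteriorCochain k j Ψ ∘ Subtype.val ∈
      LinearMap.ker (K.coboundary k _ ((j : ℤ) - i - 1) ((j : ℤ) - i - 1 + 1))),
      Submodule.mkQ _ ⟨_, hΨ⟩ = y := by
  obtain ⟨⟨ψ, hψ⟩, rfl⟩ := Submodule.mkQ_surjective _ y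
  obtain ⟨ψ, rfl⟩ := K.surjective_comp_val ψ
  obtain ⟨Ψ, rfl⟩ := exteriorCochain_surjective ψ
  exact ⟨Ψ, hψ, rfl⟩

lemma cohomologyClasses_surjective : Function.Surjective (K.cohomologyClasses k i) := by
  intro y
  choose Ψ hΨ hy using fun j => exists_mkQ_exteriorCochain_eq (y j)
  let cardFin (U : Finset (Fin n)) : Fin (n + 1) :=
    ⟨#U, Nat.lt_succ_of_le (card_finset_fin_le U)⟩
  let diagonal (U : Finset (Fin n)) : Finset (Fin n) → k := Ψ (cardFin U) U
  have hdiagonal (j : Fin (n + 1)) : exteriorCochain k j diagonal = exteriorCochain k j (Ψ j) :=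
    exteriorCochain_congr fun U hU => congrArg (Ψ · U) (Fin.ext hU)
  have hmem : diagonal ∈ K.cocycleFamilies k i := fun U hU =>
    isCocycleOn_exteriorCochain_iff.mp
      (comp_val_mem_ker_coboundary_sub_iff.mp (hΨ (cardFin U)) hU) U rfl
  exact ⟨⟨diagonal, hmem⟩, funext fun j => (congrArg (Submodule.mkQ _)
    (Subtype.ext (congrArg (· ∘ Subtype.val) (hdiagonal j)))).trans (hy j)⟩

end Cohomology

section Tor

variable {K k} {c i : ℕ}

/-- The Koszul homology of the face ring as a sum of cohomology spaces. -/
noncomputable def cohomologyEquiv (h : LinksAcyclic k K.toLowerSet c) (hi : n < i + 1 + c) :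
    Homology (X : Fin n → MvPolynomial (Fin n) k) (K.FaceRing k) i ≃ₗ[k]
      DirectSum (Fin (n + 1)) fun j =>
        K.ReducedCohomology k (⋀[k]^(j : ℕ) (Fin n → k)) ((j : ℤ) - (i + 1 : ℕ) - 1) :=
  have hker : LinearMap.ker (K.homologyClass k i) =
      LinearMap.ker (K.cohomologyClasses k (i + 1)) :=
    Submodule.ext fun _ => (homologyClass_eq_zero_iff h hi).trans cohomologyClasses_eq_zero_iff.symm
  ((K.homologyClass k i).quotKerEquivOfSurjective (homologyClass_surjective h hi)).symm ≪≫ₗ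
    Submodule.quotEquivOfEq _ _ hker ≪≫ₗ
    (K.cohomologyClasses k (i + 1)).quotKerEquivOfSurjective cohomologyClasses_surjective ≪≫ₗ
    (DirectSum.linearEquivFunOnFintype k _ _).symm

lemma mem_span_range_X_iff {p : MvPolynomial (Fin n) k} :
    p ∈ Ideal.span (Set.range (X : Fin n → MvPolynomial (Fin n) k)) ↔ constantCoeff p = 0 := by
  rw [← Set.image_univ, mem_ideal_span_X_image, constantCoeff_eq]
  refine ⟨fun h => ?_, fun h a ha => ?_⟩
  · by_contra hne
    obtain ⟨i, -, hi⟩ := h 0 (mem_support_iff.mpr hne)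
    exact hi rfl
  · by_contra! hzero
    obtain rfl : a = 0 := Finsupp.ext fun i => hzero i trivial
    exact mem_support_iff.mp ha h

lemma smul_homology_eq_constantCoeff_smul (p : MvPolynomial (Fin n) k)
    (y : Homology (X : Fin n → MvPolynomial (Fin n) k) (K.FaceRing k) i) :
    p • y = constantCoeff p • y := by
  have hmem : p - C (constantCoeff p) ∈
      Ideal.span (Set.range (X : Fin n → MvPolynomial (Fin n) k)) := by
    rw [mem_span_range_X_iff, map_sub, constantCoeff_C, sub_self]
  have hzero := smul_homology hmem y
  rw [sub_smul, sub_eq_zero] at hzero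
  rw [hzero, ← algebraMap_eq, algebraMap_smul]

/-- An `R`-module on which `R` acts through `f : R →+* S` is a restriction of scalars. -/
noncomputable def restrictScalarsIso {R S : Type u} [CommRing R] [CommRing S] (f : R →+* S)
    {M N : Type u} [AddCommGroup M] [Module R M] [Module S M] [AddCommGroup N] [Module S N]
    (hf : ∀ (r : R) (y : M), r • y = f r • y) (e : M ≃ₗ[S] N) :
    ModuleCat.of R M ≅ (ModuleCat.restrictScalars f).obj (ModuleCat.of S N) :=
  letI : Module R N := Module.compHom N f
  LinearEquiv.toModuleIso (X₁ := M) (X₂ := N)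
    { e with map_smul' := fun r y => by rw [hf]; exact map_smul e (f r) y }

/-- The Koszul homology of the face ring as an `R`-module, in terms of the cohomology of the
complex. -/
noncomputable def homologyIso (h : LinksAcyclic k K.toLowerSet c) (hi : n < i + 1 + c) :
    ModuleCat.of (MvPolynomial (Fin n) k)
        (Homology (X : Fin n → MvPolynomial (Fin n) k) (K.FaceRing k) i) ≅
      (ModuleCat.restrictScalars (constantCoeff : MvPolynomial (Fin n) k →+* k)).obj
        (ModuleCat.of k (DirectSum (Fin (n + 1)) fun j =>
          K.ReducedCohomology k (⋀[k]^(j : ℕ) (Fin n → k)) ((j : ℤ) - (i + 1 : ℕ) - 1))) :=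
  restrictScalarsIso _ smul_homology_eq_constantCoeff_smul (cohomologyEquiv h hi)

variable (K k) in
/-- `Tor` of the face ring is Koszul homology. -/
noncomputable def torFaceRingIso (i : ℕ) : K.torFaceRing k (i + 1) ≅
    ModuleCat.of _ (Homology (X : Fin n → MvPolynomial (Fin n) k) (K.FaceRing k) i) :=
  torIso X (K.FaceRing k) (fun i => isExactAt_mvPolynomial k i.succ_pos) i

lemma subsingleton_torFaceRing_iff : Subsingleton (K.torFaceRing k (i + 1)) ↔
    IsExactAt (X : Fin n → MvPolynomial (Fin n) k) (K.FaceRing k) (i + 1) :=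
  (torFaceRingIso K k i).toLinearEquiv.toEquiv.subsingleton_congr.trans subsingleton_homology_iff

/-- `Tor` of the face ring in terms of the cohomology of the complex. -/
noncomputable def torCohomologyIso (h : LinksAcyclic k K.toLowerSet c) (hi : n < i + 1 + c) :
    K.torFaceRing k (i + 1) ≅
      (ModuleCat.restrictScalars (constantCoeff : MvPolynomial (Fin n) k →+* k)).obj
        (ModuleCat.of k (DirectSum (Fin (n + 1)) fun j =>
          K.ReducedCohomology k (⋀[k]^(j : ℕ) (Fin n → k)) ((j : ℤ) - (i + 1 : ℕ) - 1))) :=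
  torFaceRingIso K k i ≪≫ homologyIso h hi

end Tor

end FaceComplex

/-! ### The face ring at the origin -/

section LocalDepth

open RingTheory.Sequence

variable {A : Type u} [CommRing A]

lemma length_le_localDepth [IsLocalRing A] {rs : List A} (h : IsRegular A rs)
    (hrs : ∀ r ∈ rs, r ∈ IsLocalRing.maximalIdeal A) : (rs.length : ℕ∞) ≤ localDepth A :=
  le_iSup₂_of_le (f := fun (rs : List A) (_ : IsRegular A rs ∧
    ∀ r ∈ rs, r ∈ IsLocalRing.maximalIdeal A) => (rs.length : ℕ∞)) rs ⟨h, hrs⟩ le_rfl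

lemma localDepth_le_ringKrullDim [IsLocalRing A] [IsNoetherianRing A] :
    (localDepth A : WithBot ℕ∞) ≤ ringKrullDim A := by
  obtain ⟨e, he⟩ := WithBot.ne_bot_iff_exists.mp (ringKrullDim_ne_bot (R := A))
  rw [← he, WithBot.coe_le_coe]
  refine iSup₂_le fun rs h => ?_
  rw [← WithBot.coe_le_coe, he, ← ringKrullDim_add_length_eq_ringKrullDim_of_isRegular rs h.1]
  have : Nontrivial (A ⧸ Ideal.ofList rs) := Ideal.Quotient.nontrivial_iff.mpr fun htop =>
    h.1.2 (by simp [htop])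
  exact le_add_of_nonneg_left ringKrullDim_nonneg_of_nontrivial

lemma exists_isRegular_of_le_localDepth [IsLocalRing A] {c : ℕ} (h : (c : ℕ∞) ≤ localDepth A) :
    ∃ rs : List A, IsRegular A rs ∧ (∀ r ∈ rs, r ∈ IsLocalRing.maximalIdeal A) ∧
      c ≤ rs.length := by
  cases c with
  | zero => exact ⟨[], .nil A A, by simp, by simp⟩
  | succ c =>
    have hlt : (c : ℕ∞) < localDepth A := (by exact_mod_cast c.lt_succ_self : _ < _).trans_le h
    obtain ⟨rs, hrs⟩ := lt_iSup_iff.mp hlt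
    obtain ⟨⟨hreg, hmem⟩, hlen⟩ := lt_iSup_iff.mp hrs
    exact ⟨rs, hreg, hmem, by exact_mod_cast hlen⟩

lemma exists_isLocalizedModule_of_surjective {M N M' : Type*} [AddCommGroup M] [Module A M]
    [AddCommGroup N] [Module A N] [AddCommGroup M'] [Module A M'] {g : M →ₗ[A] N}
    (hg : Function.Surjective g) (S : Submonoid A) (f : M →ₗ[A] M') [IsLocalizedModule S f]
    {t : S} (ht : ∀ y, g y = 0 → t • y = 0) : ∃ f' : N →ₗ[A] M', IsLocalizedModule S f' := by
  have hle : LinearMap.ker g ≤ LinearMap.ker f := fun y hy =>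
    (IsLocalizedModule.eq_zero_iff S f).mpr ⟨t, ht y hy⟩
  let f' : N →ₗ[A] M' :=
    (LinearMap.ker g).liftQ f hle ∘ₗ (g.quotKerEquivOfSurjective hg).symm.toLinearMap
  have hf' (y : M) : f' (g y) = f y := by
    have hy : (g.quotKerEquivOfSurjective hg).symm (g y) = Submodule.Quotient.mk y :=
      (LinearEquiv.symm_apply_eq _).mpr rfl
    rw [LinearMap.comp_apply, LinearEquiv.coe_coe, hy, Submodule.liftQ_apply]
  refine ⟨f', ⟨IsLocalizedModule.map_units f, fun z => ?_, fun {y₁ y₂} h => ?_⟩⟩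
  · obtain ⟨⟨y, s⟩, hy⟩ := IsLocalizedModule.surj S f z
    exact ⟨(g y, s), hy.trans (hf' y).symm⟩
  · obtain ⟨y₁, rfl⟩ := hg y₁
    obtain ⟨y₂, rfl⟩ := hg y₂
    rw [hf', hf'] at h
    obtain ⟨s, hs⟩ := IsLocalizedModule.exists_of_eq (S := S) h
    refine ⟨s, ?_⟩
    simpa only [Submonoid.smul_def, map_smul] using congrArg g hs

lemma length_le_localDepth_of_surjective {E : Type*} [CommRing E] [Algebra A E]
    (hsurj : Function.Surjective (algebraMap A E)) (P : Ideal A) [P.IsPrime] {t : A} (ht : t ∉ P)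
    (hker : ∀ a, algebraMap A E a = 0 → t * a = 0) {rs : List E} (hreg : IsWeaklyRegular E rs)
    (hrs : ∀ r ∈ rs, r ∈ P.map (algebraMap A E)) :
    (rs.length : ℕ∞) ≤ localDepth (Localization.AtPrime P) := by
  obtain ⟨f, hf⟩ := exists_isLocalizedModule_of_surjective (g := Algebra.linearMap A E) hsurj
    P.primeCompl (Algebra.linearMap A (Localization.AtPrime P)) (t := ⟨t, ht⟩) hker
  obtain ⟨as, rfl⟩ : ∃ as : List P, as.map (fun a : P => algebraMap A E a) = rs := by
    rw [← Set.mem_range, Set.range_list_map]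
    intro r hr
    obtain ⟨a, ha, rfl⟩ := (Ideal.mem_map_iff_of_surjective _ hsurj).mp (hrs r hr)
    exact ⟨⟨a, ha⟩, rfl⟩
  have hmem : ∀ a ∈ as.map Subtype.val, a ∈ P := List.forall_mem_map.mpr fun b _ => b.2
  have hreg' : IsWeaklyRegular E (as.map Subtype.val) :=
    (isWeaklyRegular_map_algebraMap_iff E E _).mp (by rwa [List.map_map])
  have hregular := hreg'.isRegular_of_isLocalizedModule_of_mem (Localization.AtPrime P) P f hmem
  have hle := length_le_localDepth hregular fun r hr => by
    obtain ⟨a, ha, rfl⟩ := List.mem_map.mp hr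
    exact (IsLocalization.AtPrime.to_map_mem_maximal_iff _ P a).mpr (hmem a ha)
  simpa only [List.length_map] using hle

end LocalDepth

namespace Koszul

open RingTheory.Sequence

variable {ι S M : Type*} [LinearOrder ι] [Fintype ι] [CommRing S] [AddCommGroup M] [Module S M]
  {x : ι → S} {i : ℕ}

lemma isExactAt_algebraMap_iff {S' : Type*} [CommRing S'] [Algebra S S'] [Module S' M]
    [IsScalarTower S S' M] :
    IsExactAt (fun l => algebraMap S S' (x l)) M i ↔ IsExactAt x M i := by
  have hd (φ : Finset ι → M) : differential (fun l => algebraMap S S' (x l)) φ =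
      differential x φ := by
    funext T
    simp only [differential_apply, algebraMap_smul]
  simp only [IsExactAt, hd]

lemma exists_differential_eq_smul_component {M' : Type*} [AddCommGroup M'] [Module S M']
    {T : Submonoid S} (f : M →ₗ[S] M') [IsLocalizedModule T f] (h : IsExactAt x M' i)
    {φ : Finset ι → M} (hφ : differential x φ = 0) :
    ∃ s ∈ T, ∃ ψ, differential x ψ = s • component i φ := by
  let g : (Finset ι → M) →ₗ[S] (Finset ι → M') := .pi fun U => f ∘ₗ .proj U
  have hd (χ : Finset ι → M) : differential x (g χ) = g (differential x χ) :=
    differential_comp (f := f.toAddMonoidHom) (fun l y => map_smul f (x l) y) χ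
  obtain ⟨ψ', hψ'⟩ := h (g φ) (by rw [hd, hφ, map_zero])
  obtain ⟨⟨ψ, s⟩, hψ⟩ := IsLocalizedModule.surj T g ψ'
  have hgψ : g (differential x ψ) = g (s • component i φ) := by
    have hcomp : component i (g φ) = g (component i φ) :=
      funext fun U => by simp [g, component, apply_ite f]
    simp only [Submonoid.smul_def] at hψ ⊢
    rw [← hd, ← hψ, map_smul, hψ', hcomp, map_smul]
  obtain ⟨t, ht⟩ := IsLocalizedModule.exists_of_eq (S := T) hgψ
  refine ⟨t * s, (t * s).2, (t : S) • ψ, ?_⟩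
  simpa only [Submonoid.smul_def, smul_smul, map_smul] using ht

lemma IsExactAt.of_isLocalizedModule {M' : Type*} [AddCommGroup M'] [Module S M'] {P : Ideal S}
    [P.IsMaximal] (hP : P ≤ Ideal.span (Set.range x)) (f : M →ₗ[S] M')
    [IsLocalizedModule P.primeCompl f] (h : IsExactAt x M' i) : IsExactAt x M i := by
  intro φ hφ
  obtain ⟨s, hs, ψ, hψ⟩ := exists_differential_eq_smul_component (T := P.primeCompl) f h hφ
  obtain ⟨r, a, ha, hra⟩ := Ideal.IsMaximal.exists_inv (I := P) inferInstance hs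
  obtain ⟨η, hη⟩ := exists_differential_eq_smul hφ (hP ha)
  refine ⟨r • ψ + component (i + 1) η, ?_⟩
  rw [map_add, map_smul, hψ, ← component_differential, hη, component_smul, smul_smul, ← add_smul,
    hra, one_smul]

lemma isExactAt_of_le_localDepth {A : Type u} [CommRing A] {x : ι → A} {P : Ideal A}
    [P.IsMaximal] (hP : Ideal.span (Set.range x) = P) {c : ℕ}
    (hc : (c : ℕ∞) ≤ localDepth (Localization.AtPrime P)) (hi : Fintype.card ι < i + c) :
    IsExactAt x A i := by
  subst hP
  obtain ⟨rs, hreg, hmem, hlen⟩ := exists_isRegular_of_le_localDepth hc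
  have hspan : IsLocalRing.maximalIdeal (Localization.AtPrime (Ideal.span (Set.range x))) =
      Ideal.span (Set.range fun l => algebraMap A (Localization.AtPrime _) (x l)) := by
    rw [← Localization.AtPrime.map_eq_maximalIdeal, Ideal.map_span, ← Set.range_comp]
    rfl
  rw [hspan] at hmem
  exact (isExactAt_algebraMap_iff.mp (isExactAt_of_isWeaklyRegular hmem hreg.1 (by lia)))
    |>.of_isLocalizedModule le_rfl (Algebra.linearMap A (Localization.AtPrime _))

end Koszul

namespace FaceComplex

open Finset Koszul MvPolynomial

variable {n : ℕ} (K : FaceComplex (Fin n)) (k : Type u) [Field k]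

section Dimension

lemma prod_X_mem_faceIdeal {s : Finset (Fin n)} (hs : s ∉ K.faces) :
    ∏ v ∈ s, (X v : MvPolynomial (Fin n) k) ∈ K.faceIdeal k :=
  Ideal.subset_span ⟨s, hs, rfl⟩

/-- The restriction of polynomial functions to the coordinate subspace of a face: the variables
outside the face are set to zero. -/
noncomputable def faceEval {F : Finset (Fin n)} (hF : F ∈ K.faces) :
    K.FaceRing k →ₐ[k] MvPolynomial (Fin n) k :=
  Ideal.Quotient.liftₐ (K.faceIdeal k) (aeval fun v => if v ∈ F then X v else 0) <| by
    intro p hp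
    rw [← RingHom.mem_ker]
    refine Ideal.span_le.mpr ?_ hp
    rintro _ ⟨s, hs, rfl⟩
    obtain ⟨v, hvs, hvF⟩ := not_subset.mp fun hsF => hs (K.down_closed hF hsF)
    rw [SetLike.mem_coe, RingHom.mem_ker, map_prod]
    exact prod_eq_zero hvs (by simp [hvF])

variable {K}

lemma faceEval_mk {F : Finset (Fin n)} (hF : F ∈ K.faces) (p : MvPolynomial (Fin n) k) :
    K.faceEval k hF (Ideal.Quotient.mk _ p) = aeval (fun v => if v ∈ F then X v else 0) p :=
  rfl

lemma faceEval_mk_X {F : Finset (Fin n)} (hF : F ∈ K.faces) (v : Fin n) :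
    K.faceEval k hF (Ideal.Quotient.mk _ (X v)) = if v ∈ F then X v else 0 := by
  rw [faceEval_mk, aeval_X]

lemma ker_faceEval_lt {F : Finset (Fin n)} {v : Fin n} (hv : v ∉ F) (hF : insert v F ∈ K.faces) :
    RingHom.ker (K.faceEval k hF) <
      RingHom.ker (K.faceEval k (K.down_closed hF (subset_insert v F))) := by
  refine lt_of_le_not_ge (fun a ha => ?_) fun hle => ?_
  · obtain ⟨p, rfl⟩ := Ideal.Quotient.mk_surjective a
    rw [RingHom.mem_ker, faceEval_mk] at ha ⊢
    have hp := congrArg (aeval fun w => if w ∈ F then (X w : MvPolynomial (Fin n) k) else 0) ha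
    rw [map_zero, ← AlgHom.comp_apply, comp_aeval] at hp
    refine Eq.trans ?_ hp
    congr 2
    funext w
    by_cases hw : w ∈ F <;> by_cases hwv : w = v <;> simp [hw, hwv]
  · have hmem : Ideal.Quotient.mk (K.faceIdeal k) (X v) ∈ RingHom.ker (K.faceEval k hF) :=
      hle (by rw [RingHom.mem_ker, faceEval_mk_X, if_neg hv])
    rw [RingHom.mem_ker, faceEval_mk_X, if_pos (mem_insert_self v F)] at hmem
    exact X_ne_zero v hmem

lemma card_le_height_ker_faceEval {G T : Finset (Fin n)} (hGT : Disjoint G T)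
    (hunion : G ∪ T ∈ K.faces) (hG : G ∈ K.faces) :
    (#T : ℕ∞) ≤ (RingHom.ker (K.faceEval k hG)).height := by
  induction T using Finset.induction_on generalizing G with
  | empty => simp
  | insert v T hv ih =>
    obtain ⟨hvG, hGT⟩ := disjoint_insert_right.mp hGT
    have hunion' : insert v G ∪ T ∈ K.faces := by rwa [insert_union, ← union_insert]
    have hG' : insert v G ∈ K.faces := K.down_closed hunion' subset_union_left
    have := RingHom.ker_isPrime (K.faceEval k hG)
    have := RingHom.ker_isPrime (K.faceEval k hG')
    calc (#(insert v T) : ℕ∞) = #T + 1 := by rw [card_insert_of_notMem hv, Nat.cast_add_one]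
      _ ≤ (RingHom.ker (K.faceEval k hG')).height + 1 :=
        add_le_add_left (ih (disjoint_insert_left.mpr ⟨hv, hGT⟩) hunion' hG') 1
      _ ≤ (RingHom.ker (K.faceEval k hG)).height :=
        Ideal.height_add_one_le_of_lt_of_isPrime (ker_faceEval_lt k hvG hG')

variable {k}

lemma mem_faces_of_notMem {P : Ideal (K.FaceRing k)} [P.IsPrime] {F : Finset (Fin n)}
    (hF : ∀ v ∈ F, Ideal.Quotient.mk (K.faceIdeal k) (X v) ∉ P) : F ∈ K.faces := by
  by_contra hnot
  have hmem : ∏ v ∈ F, Ideal.Quotient.mk (K.faceIdeal k) (X v) ∈ P := by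
    rw [← map_prod, Ideal.Quotient.eq_zero_iff_mem.mpr (K.prod_X_mem_faceIdeal k hnot)]
    exact P.zero_mem
  obtain ⟨v, hv, hvP⟩ := Ideal.IsPrime.prod_mem_iff.mp hmem
  exact hF v hv hvP

lemma ringKrullDim_quotient_le_card (P : Ideal (K.FaceRing k)) [Nontrivial (K.FaceRing k ⧸ P)]
    {F : Finset (Fin n)} (hF : ∀ v ∉ F, Ideal.Quotient.mk (K.faceIdeal k) (X v) ∈ P) :
    ringKrullDim (K.FaceRing k ⧸ P) ≤ #F := by
  let π : MvPolynomial (Fin n) k →ₐ[k] K.FaceRing k ⧸ P :=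
    (Ideal.Quotient.mkₐ k P).comp (Ideal.Quotient.mkₐ k (K.faceIdeal k))
  let f : MvPolynomial F k →ₐ[k] K.FaceRing k ⧸ P := aeval fun v => π (X v.1)
  have hπ : π = f.comp (aeval fun v => if h : v ∈ F then X ⟨v, h⟩ else 0) := by
    refine algHom_ext fun v => ?_
    by_cases hv : v ∈ F
    · simp [f, hv]
    · simpa [π, hv] using Ideal.Quotient.eq_zero_iff_mem.mpr (hF v hv)
  have hf : Function.Surjective f := fun y => by
    obtain ⟨a, rfl⟩ := Ideal.Quotient.mk_surjective y
    obtain ⟨p, rfl⟩ := Ideal.Quotient.mk_surjective a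
    exact ⟨_, (DFunLike.congr_fun hπ p).symm⟩
  calc ringKrullDim (K.FaceRing k ⧸ P) ≤ ringKrullDim (MvPolynomial F k) :=
        ringKrullDim_le_of_surjective f.toRingHom hf
    _ = #F := by
        rw [ringKrullDim_of_isNoetherianRing, ringKrullDim_eq_zero_of_field]
        simp

variable (K k) in
lemma ringKrullDim_faceRing_le : ringKrullDim (K.FaceRing k) ≤ (K.faces.sup card : ℕ) := by
  classical
  refine iSup_le fun l => ?_
  let P := l.head.asIdeal
  let F : Finset (Fin n) := {v | Ideal.Quotient.mk (K.faceIdeal k) (X v) ∉ P}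
  have hF : F ∈ K.faces := mem_faces_of_notMem (P := P) fun v hv => (mem_filter.mp hv).2
  let l' : LTSeries (PrimeSpectrum.zeroLocus (P : Set (K.FaceRing k))) :=
    { length := l.length
      toFun := fun i => ⟨l i, l.head_le i⟩
      step := fun i => l.step i }
  calc (l.length : WithBot ℕ∞) ≤ ringKrullDim (K.FaceRing k ⧸ P) := by
        rw [ringKrullDim_quotient]
        exact Order.LTSeries.length_le_krullDim l'
    _ ≤ #F := ringKrullDim_quotient_le_card P fun v hv => by simpa [F] using hv
    _ ≤ (K.faces.sup card : ℕ) := by exact_mod_cast le_sup (f := card) hF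

end Dimension

section Origin

/-- The ideal of the face ring generated by the variables. -/
noncomputable def originIdeal : Ideal (K.FaceRing k) :=
  Ideal.span (Set.range fun v => Ideal.Quotient.mk (K.faceIdeal k) (X v))

variable {K k} in
lemma constantCoeff_eq_zero_of_mem_faceIdeal {p : MvPolynomial (Fin n) k}
    (hp : p ∈ K.faceIdeal k) : constantCoeff p = 0 := by
  by_contra hne
  exact K.mem_faceIdeal_iff.mp hp 0 (mem_support_iff.mpr hne) K.empty_mem

lemma originIdeal_eq_ker : K.originIdeal k = RingHom.ker (Ideal.Quotient.lift (K.faceIdeal k)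
    constantCoeff fun _ => constantCoeff_eq_zero_of_mem_faceIdeal) := by
  have hker : RingHom.ker (constantCoeff : MvPolynomial (Fin n) k →+* k) =
      Ideal.span (Set.range X) :=
    Ideal.ext fun p => mem_span_range_X_iff.symm
  refine Eq.trans ?_ (Ideal.ker_quotient_lift _ _).symm
  rw [hker, Ideal.map_span, ← Set.range_comp]
  rfl

instance : (K.originIdeal k).IsMaximal := by
  rw [originIdeal_eq_ker]
  exact RingHom.ker_isMaximal_of_surjective _ fun a => ⟨Ideal.Quotient.mk _ (C a), by simp⟩

lemma ker_faceEval_empty_le_originIdeal :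
    RingHom.ker (K.faceEval k K.empty_mem) ≤ K.originIdeal k := by
  intro a ha
  obtain ⟨p, rfl⟩ := Ideal.Quotient.mk_surjective a
  rw [RingHom.mem_ker, faceEval_mk] at ha
  rw [originIdeal_eq_ker, RingHom.mem_ker, Ideal.Quotient.lift_mk]
  simpa only [notMem_empty, if_false, aeval_zero', FaithfulSMul.algebraMap_eq_zero_iff] using ha

lemma le_height_originIdeal : ((K.faces.sup card : ℕ) : ℕ∞) ≤ (K.originIdeal k).height := by
  obtain ⟨F, hF, hcard⟩ := exists_mem_eq_sup K.faces ⟨∅, K.empty_mem⟩ card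
  rw [hcard]
  exact (card_le_height_ker_faceEval k (disjoint_empty_left F) (by rwa [empty_union])
    K.empty_mem).trans (Ideal.height_mono (K.ker_faceEval_empty_le_originIdeal k))

variable {K k}

lemma isExactAt_of_isCohenMacaulayRing (h : IsCohenMacaulayRing (K.FaceRing k)) {i : ℕ}
    (hi : n < i + K.faces.sup card) :
    IsExactAt (X : Fin n → MvPolynomial (Fin n) k) (K.FaceRing k) i := by
  have hdepth : ((K.faces.sup card : ℕ) : ℕ∞) ≤
      localDepth (Localization.AtPrime (K.originIdeal k)) := by
    rw [← WithBot.coe_le_coe, h.2 (K.originIdeal k),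
      IsLocalization.AtPrime.ringKrullDim_eq_height (K.originIdeal k), WithBot.coe_le_coe]
    exact K.le_height_originIdeal k
  exact isExactAt_algebraMap_iff.mp
    (isExactAt_of_le_localDepth (P := K.originIdeal k) rfl hdepth (by rwa [Fintype.card_fin]))

end Origin

end FaceComplex

/-! ### Stars of faces and the Cohen–Macaulay property -/

open scoped Polynomial in
lemma exists_monic_aeval_mem (R : Type*) {A : Type*} [CommRing R] [IsJacobsonRing R] [CommRing A]
    [Algebra R A] [Algebra.FiniteType R A] (P : Ideal A) [P.IsMaximal] (a : A) :
    ∃ g : R[X], g.Monic ∧ Polynomial.aeval a g ∈ P := by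
  let := Ideal.Quotient.field P
  have : Module.Finite R (A ⧸ P) := finite_of_finite_type_of_isJacobsonRing R (A ⧸ P)
  obtain ⟨g, hg, h₀⟩ := Algebra.IsIntegral.isIntegral (R := R) (Ideal.Quotient.mkₐ R P a)
  refine ⟨g, hg, Ideal.Quotient.eq_zero_iff_mem.mp ?_⟩
  rwa [← Polynomial.aeval_def, Polynomial.aeval_algHom_apply] at h₀

namespace FaceComplex

open Finset Koszul MvPolynomial RingTheory.Sequence

section Star

variable {V : Type} [DecidableEq V] (K : FaceComplex V) {F G : Finset V}

/-- The (closed) star of a face `F`: the faces `G` such that `F ∪ G` is a face. -/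
def closedStar (hF : F ∈ K.faces) : FaceComplex V where
  faces := {G ∈ K.faces | F ∪ G ∈ K.faces}
  empty_mem := by simp [K.empty_mem, hF]
  down_closed := by
    intro G H hG hHG
    rw [mem_filter] at hG ⊢
    exact ⟨K.down_closed hG.1 hHG, K.down_closed hG.2 (union_subset_union_right hHG)⟩

variable {K} (hF : F ∈ K.faces)

lemma mem_closedStar : G ∈ (K.closedStar hF).faces ↔ F ∪ G ∈ K.faces :=
  mem_filter.trans (and_iff_right_of_imp fun h => K.down_closed h subset_union_right)

lemma mem_link : G ∈ (K.link F hF).faces ↔ Disjoint F G ∧ F ∪ G ∈ K.faces :=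
  mem_filter.trans (and_iff_right_of_imp fun h => K.down_closed h.2 subset_union_right)

end Star

section StarRing

variable {n : ℕ} {K : FaceComplex (Fin n)} {F : Finset (Fin n)} (hF : F ∈ K.faces) (k : Type u)
  [Field k]

lemma prod_X_mul_mem_faceIdeal_iff {p : MvPolynomial (Fin n) k} :
    (∏ v ∈ F, X v) * p ∈ K.faceIdeal k ↔ p ∈ (K.closedStar hF).faceIdeal k := by
  simp only [mem_faceIdeal_iff, mem_closedStar, prod_X_eq_monomial_squarefreeExponent]
  have hsupport (a : Fin n →₀ ℕ) : (squarefreeExponent F + a).support = F ∪ a.support := by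
    ext v
    by_cases hv : v ∈ F <;> simp [squarefreeExponent, Finsupp.indicator_apply, hv]
  refine ⟨fun h a ha => ?_, fun h a ha => ?_⟩
  · rw [← hsupport]
    exact h _ (by simpa [mem_support_iff] using ha)
  · rw [mem_support_iff, coeff_monomial_mul'] at ha
    obtain ⟨hle, ha⟩ := ite_ne_right_iff.mp ha
    rw [← add_tsub_cancel_of_le hle, hsupport]
    exact h _ (mem_support_iff.mpr (by simpa using ha))

lemma faceIdeal_le_faceIdeal_closedStar : K.faceIdeal k ≤ (K.closedStar hF).faceIdeal k :=
  fun _ hp => (prod_X_mul_mem_faceIdeal_iff hF k).mp (Ideal.mul_mem_left _ _ hp)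

/-- The restriction of functions to the star of `F`. -/
noncomputable def restrictToStar : K.FaceRing k →ₐ[k] (K.closedStar hF).FaceRing k :=
  Ideal.Quotient.factorₐ k (faceIdeal_le_faceIdeal_closedStar hF k)

lemma restrictToStar_mk (p : MvPolynomial (Fin n) k) :
    restrictToStar hF k (Ideal.Quotient.mk _ p) = Ideal.Quotient.mk _ p :=
  rfl

lemma mk_X_link_of_mem {v : Fin n} (hv : v ∈ F) :
    Ideal.Quotient.mk ((K.link F hF).faceIdeal k) (X v) = 0 := by
  have hface : {v} ∉ (K.link F hF).faces := fun h =>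
    disjoint_singleton_right.mp ((mem_link hF).mp h).1 hv
  simpa using Ideal.Quotient.eq_zero_iff_mem.mpr ((K.link F hF).prod_X_mem_faceIdeal k hface)

/-- The pullback of functions along the retraction of the star of `F` onto the link of `F`: the
variables in `F` are set to zero. -/
noncomputable def linkToStar : (K.link F hF).FaceRing k →ₐ[k] (K.closedStar hF).FaceRing k :=
  Ideal.Quotient.liftₐ _ (aeval fun v => if v ∈ F then 0 else Ideal.Quotient.mk _ (X v)) <| by
    intro p hp
    rw [← RingHom.mem_ker]
    refine Ideal.span_le.mpr ?_ hp
    rintro _ ⟨s, hs, rfl⟩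
    rw [SetLike.mem_coe, RingHom.mem_ker, map_prod]
    by_cases hd : Disjoint F s
    · have hstar : s ∉ (K.closedStar hF).faces := fun h =>
        hs ((mem_link hF).mpr ⟨hd, (mem_closedStar hF).mp h⟩)
      rw [← Ideal.Quotient.eq_zero_iff_mem.mpr ((K.closedStar hF).prod_X_mem_faceIdeal k hstar),
        map_prod]
      exact prod_congr rfl fun v hv => by rw [aeval_X, if_neg (disjoint_right.mp hd hv)]
    · obtain ⟨v, hvF, hvs⟩ := not_disjoint_iff.mp hd
      exact prod_eq_zero hvs (by simp [hvF])

lemma linkToStar_mk (p : MvPolynomial (Fin n) k) : linkToStar hF k (Ideal.Quotient.mk _ p) =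
    aeval (fun v => if v ∈ F then 0 else Ideal.Quotient.mk _ (X v)) p :=
  rfl

/-- A function on the star of `F`, as a polynomial in the variables of `F` whose coefficients are
functions on the link of `F`. -/
noncomputable def starToMvPolynomial :
    (K.closedStar hF).FaceRing k →ₐ[k] MvPolynomial F ((K.link F hF).FaceRing k) :=
  Ideal.Quotient.liftₐ _
    (aeval fun v => if h : v ∈ F then X ⟨v, h⟩ else C (Ideal.Quotient.mk _ (X v))) <| by
    intro p hp
    rw [← RingHom.mem_ker]
    refine Ideal.span_le.mpr ?_ hp
    rintro _ ⟨s, hs, rfl⟩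
    have hlink : s \ F ∉ (K.link F hF).faces := fun h => hs <| (mem_closedStar hF).mpr <| by
      simpa using ((mem_link hF).mp h).2
    have hzero : ∏ v ∈ s \ F, (C (Ideal.Quotient.mk ((K.link F hF).faceIdeal k) (X v)) :
        MvPolynomial F ((K.link F hF).FaceRing k)) = 0 := by
      rw [← map_prod, ← map_prod,
        Ideal.Quotient.eq_zero_iff_mem.mpr ((K.link F hF).prod_X_mem_faceIdeal k hlink), map_zero]
    rw [SetLike.mem_coe, RingHom.mem_ker, map_prod, ← prod_sdiff (sdiff_subset : s \ F ⊆ s)]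
    refine mul_eq_zero_of_right _ ((prod_congr rfl fun v hv => ?_).trans hzero)
    rw [aeval_X, dif_neg (mem_sdiff.mp hv).2]

lemma starToMvPolynomial_mk (p : MvPolynomial (Fin n) k) :
    starToMvPolynomial hF k (Ideal.Quotient.mk _ p) =
      aeval (fun v => if h : v ∈ F then X ⟨v, h⟩ else C (Ideal.Quotient.mk _ (X v))) p :=
  rfl

/-- The star of `F` is the join of the simplex `F` and the link of `F`. -/
noncomputable def starAlgEquiv :
    MvPolynomial F ((K.link F hF).FaceRing k) ≃ₐ[k] (K.closedStar hF).FaceRing k :=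
  .ofAlgHom (aevalTower (linkToStar hF k) fun v => Ideal.Quotient.mk _ (X v.1))
    (starToMvPolynomial hF k)
    (by
      refine Ideal.Quotient.algHom_ext _ (algHom_ext fun v => ?_)
      by_cases hv : v ∈ F <;> simp [starToMvPolynomial_mk, linkToStar_mk, hv])
    (by
      refine algHom_ext' (Ideal.Quotient.algHom_ext _ (algHom_ext fun v => ?_)) fun v => ?_
      · by_cases hv : v ∈ F <;>
          simp [linkToStar_mk, starToMvPolynomial_mk, hv, mk_X_link_of_mem]
      · simp [starToMvPolynomial_mk])

lemma starAlgEquiv_C (a : (K.link F hF).FaceRing k) :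
    starAlgEquiv hF k (C a) = linkToStar hF k a :=
  aevalTower_C _ _ a

lemma starAlgEquiv_X (v : F) : starAlgEquiv hF k (X v) = Ideal.Quotient.mk _ (X v.1) :=
  aevalTower_X _ _ v

end StarRing

section Depth

variable {n : ℕ} {K : FaceComplex (Fin n)} {F : Finset (Fin n)} (hF : F ∈ K.faces) {k : Type u}
  [Field k]

lemma linkToStar_mk_mem_map {P : Ideal (K.FaceRing k)}
    (hP : ∀ v ∉ F, Ideal.Quotient.mk (K.faceIdeal k) (X v) ∈ P) {p : MvPolynomial (Fin n) k}
    (hp : p ∈ Ideal.span (Set.range X)) :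
    linkToStar hF k (Ideal.Quotient.mk _ p) ∈ P.map (restrictToStar hF k) := by
  let φ : MvPolynomial (Fin n) k →ₐ[k] (K.closedStar hF).FaceRing k :=
    (linkToStar hF k).comp (Ideal.Quotient.mkₐ k _)
  suffices h : Ideal.span (Set.range X) ≤ (P.map (restrictToStar hF k)).comap φ from h hp
  refine Ideal.span_le.mpr ?_
  rintro _ ⟨v, rfl⟩
  change linkToStar hF k (Ideal.Quotient.mk _ (X v)) ∈ P.map (restrictToStar hF k)
  rw [linkToStar_mk, aeval_X]
  split_ifs with hv
  · exact Ideal.zero_mem _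
  · exact Ideal.mem_map_of_mem (restrictToStar hF k) (hP v hv)

lemma exists_isWeaklyRegular_closedStar (P : Ideal (K.FaceRing k)) [P.IsMaximal]
    (hP : ∀ v ∉ F, Ideal.Quotient.mk (K.faceIdeal k) (X v) ∈ P) {ds : List (MvPolynomial (Fin n) k)}
    (hds : ∀ p ∈ ds, p ∈ Ideal.span (Set.range X))
    (hreg : IsWeaklyRegular ((K.link F hF).FaceRing k) ds) :
    ∃ rs : List ((K.closedStar hF).FaceRing k), rs.length = ds.length + #F ∧
      IsWeaklyRegular ((K.closedStar hF).FaceRing k) rs ∧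
      ∀ r ∈ rs, r ∈ P.map (restrictToStar hF k) := by
  choose g hg hgP using fun v : F => exists_monic_aeval_mem k P (Ideal.Quotient.mk _ (X v.1))
  obtain ⟨l, hlen, hl⟩ := exists_isWeaklyRegular_mvPolynomial F
    ((isWeaklyRegular_map_algebraMap_iff ((K.link F hF).FaceRing k) _ ds).mpr hreg)
    (fun v => (hg v).map (algebraMap k _))
  refine ⟨_, ?_, isWeaklyRegular_map_ringEquiv (starAlgEquiv hF k).toRingEquiv hl, fun r hr => ?_⟩
  · simp [hlen]
  · obtain ⟨y, hy, rfl⟩ := List.mem_map.mp hr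
    rcases List.mem_append.mp hy with hy | hy
    · rw [List.map_map] at hy
      obtain ⟨p, hp, rfl⟩ := List.mem_map.mp hy
      change starAlgEquiv hF k (C (Ideal.Quotient.mk _ p)) ∈ P.map (restrictToStar hF k)
      rw [starAlgEquiv_C]
      exact linkToStar_mk_mem_map hF hP (hds p hp)
    · obtain ⟨v, -, rfl⟩ := List.mem_map.mp hy
      change starAlgEquiv hF k _ ∈ P.map (restrictToStar hF k)
      rw [Polynomial.aeval_map_algebraMap, ← Polynomial.aeval_algHom_apply, starAlgEquiv_X]
      simpa only [← Polynomial.aeval_algHom_apply, restrictToStar_mk] using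
        Ideal.mem_map_of_mem (restrictToStar hF k) (hgP v)

lemma length_add_card_le_localDepth (P : Ideal (K.FaceRing k)) [P.IsMaximal]
    (hP : ∀ v, v ∈ F ↔ Ideal.Quotient.mk (K.faceIdeal k) (X v) ∉ P)
    {ds : List (MvPolynomial (Fin n) k)} (hds : ∀ p ∈ ds, p ∈ Ideal.span (Set.range X))
    (hreg : IsWeaklyRegular ((K.link F hF).FaceRing k) ds) :
    ((ds.length + #F : ℕ) : ℕ∞) ≤ localDepth (Localization.AtPrime P) := by
  obtain ⟨rs, hlen, hrs, hmem⟩ := exists_isWeaklyRegular_closedStar hF P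
    (fun v hv => not_not.mp (mt (hP v).mpr hv)) hds hreg
  let := (restrictToStar hF k).toAlgebra
  rw [← hlen]
  refine length_le_localDepth_of_surjective
    (Ideal.Quotient.factor_surjective (faceIdeal_le_faceIdeal_closedStar hF k)) P
    (t := Ideal.Quotient.mk _ (∏ v ∈ F, X v)) ?_ (fun a ha => ?_) hrs hmem
  · rw [map_prod, Ideal.IsPrime.prod_mem_iff]
    rintro ⟨v, hv, hvP⟩
    exact (hP v).mp hv hvP
  · obtain ⟨p, rfl⟩ := Ideal.Quotient.mk_surjective a
    rw [← map_mul, Ideal.Quotient.eq_zero_iff_mem, prod_X_mul_mem_faceIdeal_iff hF]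
    exact Ideal.Quotient.eq_zero_iff_mem.mp ha

end Depth

section CohenMacaulay

open FaceCochain (Acyclic LinksAcyclic acyclic_bot link_link)

variable {n : ℕ} {K : FaceComplex (Fin n)} {k : Type u} [Field k]

variable (K) in
lemma sup_card_le : K.faces.sup card ≤ n :=
  Finset.sup_le fun s _ => (card_le_univ s).trans_eq (Fintype.card_fin n)

lemma linksAcyclic_link {F : Finset (Fin n)} (hF : F ∈ K.faces)
    (h : LinksAcyclic k K.toLowerSet (K.faces.sup card)) :
    LinksAcyclic k (K.link F hF).toLowerSet (K.faces.sup card - #F) := by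
  intro G m hG hm
  rw [toLowerSet_link]
  by_cases hd : Disjoint G F
  · rw [link_link hd]
    exact h _ _ (hG.mono subset_union_left) (by rw [card_union_of_disjoint hd]; lia)
  · have hbot : FaceCochain.link (FaceCochain.link K.toLowerSet F) G = ⊥ :=
      eq_bot_iff.mpr fun H hH => hd (disjoint_union_left.mp hH.2.1).2
    rw [hbot]
    exact acyclic_bot

lemma exists_isWeaklyRegular_link {F : Finset (Fin n)} (hF : F ∈ K.faces)
    (h : LinksAcyclic k K.toLowerSet (K.faces.sup card))
    (h₀ : ∀ m < K.faces.sup card, Acyclic k K.toLowerSet m) :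
    ∃ ds : List (MvPolynomial (Fin n) k), ds.length = K.faces.sup card - #F ∧
      (∀ p ∈ ds, p ∈ Ideal.span (Set.range X)) ∧
      IsWeaklyRegular ((K.link F hF).FaceRing k) ds := by
  have hn := K.sup_card_le
  have hacyclic (m : ℕ) (hm : m < K.faces.sup card - #F) :
      Acyclic k (K.link F hF).toLowerSet m := by
    rw [toLowerSet_link]
    rcases F.eq_empty_or_nonempty with rfl | hF'
    · rw [FaceCochain.link_empty]
      exact h₀ m (by lia)
    · exact h F m hF' (by lia)
  exact exists_isWeaklyRegular (by rw [Fintype.card_fin]; lia) fun i hi =>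
    isExactAt_of_linksAcyclic (linksAcyclic_link hF h) hacyclic (by rwa [Fintype.card_fin] at hi)

lemma isCohenMacaulayRing_of_acyclic (h : LinksAcyclic k K.toLowerSet (K.faces.sup card))
    (h₀ : ∀ m < K.faces.sup card, Acyclic k K.toLowerSet m) :
    IsCohenMacaulayRing (K.FaceRing k) := by
  classical
  refine ⟨inferInstance, fun P _ => le_antisymm localDepth_le_ringKrullDim ?_⟩
  let F : Finset (Fin n) := {v | Ideal.Quotient.mk (K.faceIdeal k) (X v) ∉ P}
  have hF : F ∈ K.faces := mem_faces_of_notMem (P := P) fun v hv => (mem_filter.mp hv).2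
  have hcard : #F ≤ K.faces.sup card := le_sup (f := card) hF
  obtain ⟨ds, hlen, hds, hreg⟩ := exists_isWeaklyRegular_link hF h h₀
  have hdepth := length_add_card_le_localDepth hF P (by simp [F]) hds hreg
  rw [hlen, Nat.sub_add_cancel hcard] at hdepth
  calc ringKrullDim (Localization.AtPrime P) = P.height :=
        IsLocalization.AtPrime.ringKrullDim_eq_height P (Localization.AtPrime P)
    _ ≤ ringKrullDim (K.FaceRing k) := Ideal.height_le_ringKrullDim_of_isPrime
    _ ≤ (K.faces.sup card : ℕ) := ringKrullDim_faceRing_le K k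
    _ ≤ localDepth (Localization.AtPrime P) := by exact_mod_cast hdepth

lemma isExactAt_iff_acyclic (h : LinksAcyclic k K.toLowerSet (K.faces.sup card)) :
    (∀ i : ℕ, n < i + K.faces.sup card →
      IsExactAt (X : Fin n → MvPolynomial (Fin n) k) (K.FaceRing k) i) ↔
      ∀ m < K.faces.sup card, Acyclic k K.toLowerSet m := by
  have hn := K.sup_card_le
  exact ⟨fun h' m hm => acyclic_of_isExactAt (i := n - m) (by lia) (h' _ (by lia)),
    fun h₀ i hi => isExactAt_of_linksAcyclic h h₀ hi⟩

lemma isExactAt_iff_isCohenMacaulayRing (h : LinksAcyclic k K.toLowerSet (K.faces.sup card)) :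
    (∀ i : ℕ, n < i + K.faces.sup card →
      IsExactAt (X : Fin n → MvPolynomial (Fin n) k) (K.FaceRing k) i) ↔
      IsCohenMacaulayRing (K.FaceRing k) :=
  ⟨fun h' => isCohenMacaulayRing_of_acyclic h ((isExactAt_iff_acyclic h).mp h'),
    fun h' _ hi => isExactAt_of_isCohenMacaulayRing h' hi⟩

variable (K k)

lemma subsingleton_reducedHomology_lt_dim_iff :
    (∀ i : ℤ, i < K.dim → Subsingleton (K.ReducedHomology k k i)) ↔
      ∀ m < K.faces.sup card, Acyclic k K.toLowerSet m := by
  rw [dim]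
  refine ⟨fun h m hm => (subsingleton_reducedHomology_iff _ (i := m - 1) rfl).mp (h _ (by lia)),
    fun h i hi => ?_⟩
  by_cases hlt : i < -1
  · exact subsingleton_reducedHomology_of_lt _ hlt
  · exact (subsingleton_reducedHomology_iff _ (m := (i + 1).toNat) (by lia)).mpr (h _ (by lia))

lemma subsingleton_torFaceRing_gt_iff :
    (∀ i : ℕ, (n : ℤ) - K.dim - 1 < i → Subsingleton (K.torFaceRing k i)) ↔
      ∀ i : ℕ, n < i + K.faces.sup card →
        IsExactAt (X : Fin n → MvPolynomial (Fin n) k) (K.FaceRing k) i := by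
  have hn := K.sup_card_le
  refine forall_congr' fun i => imp_congr_ctx (by rw [dim]; lia) fun hi => ?_
  obtain ⟨j, rfl⟩ : ∃ j, i = j + 1 := ⟨i - 1, by lia⟩
  exact subsingleton_torFaceRing_iff

end CohenMacaulay

end FaceComplex

theorem mainTheorem2 {k : Type u} [Field k] {n : ℕ} (K : FaceComplex (Fin n))
    (hvert : ∀ v : Fin n, {v} ∈ K.faces) (d : ℤ) (hdim : K.dim = d) (hpure : K.IsPure)
    (hlink : ∀ (σ : Finset (Fin n)) (hσ : σ ∈ K.faces), σ.Nonempty →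
      ∀ i : ℤ, i < (K.link σ hσ).dim → Subsingleton ((K.link σ hσ).ReducedHomology k k i)) :
    (∀ i : ℕ, (n : ℤ) - d - 1 < i →
      Nonempty (K.torFaceRing k i ≅
        (ModuleCat.restrictScalars
          (MvPolynomial.constantCoeff : MvPolynomial (Fin n) k →+* k)).obj
          (ModuleCat.of k (DirectSum (Fin (n + 1)) fun j =>
            K.ReducedCohomology k (⋀[k]^(j : ℕ) (Fin n → k)) ((j : ℤ) - i - 1))))) ∧
    ((∀ i : ℤ, i < d → Subsingleton (K.ReducedHomology k k i)) ↔
      ∀ i : ℕ, (n : ℤ) - d - 1 < i → Subsingleton (K.torFaceRing k i)) ∧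
    ((∀ i : ℕ, (n : ℤ) - d - 1 < i → Subsingleton (K.torFaceRing k i)) ↔
      IsCohenMacaulayRing (K.FaceRing k)) := by
  subst hdim
  have h := hpure.linksAcyclic hlink
  have hn := K.sup_card_le
  rw [K.subsingleton_torFaceRing_gt_iff k, K.subsingleton_reducedHomology_lt_dim_iff k]
  refine ⟨fun i hi => ?_, (FaceComplex.isExactAt_iff_acyclic h).symm,
    FaceComplex.isExactAt_iff_isCohenMacaulayRing h⟩
  rw [FaceComplex.dim] at hi
  obtain ⟨j, rfl⟩ : ∃ j, i = j + 1 := ⟨i - 1, by lia⟩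
  exact ⟨FaceComplex.torCohomologyIso h (by lia)⟩
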